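/- Let $X$ be a complex Banach space and let $-A$ be the generator of a bounded $C_0$-semigroup $(e^{-tA})_{t\ge 0}$ on $X$; put $M:=\sup_{t\ge 0}\|e^{-tA}\|$. A function $g\in C^\infty(0,\infty)$ is completely monotone if $(-1)^k g^{(k)}(z)\ge 0$ for all $z>0$ and $k=0,1,2,\dots$, and one writes $g^{(k)}(0):=\lim_{z\to 0+}g^{(k)}(z)$. Let $(g_t)_{t>0}$ be a family of completely monotone functions such that for every $t>0$ $$g_t(0)=1,\qquad g_t'(0)=-1,\qquad g_t''(0)<\infty,\qquad |g_t'''(0)|<\infty,\qquad g_t''''(0)<\infty .$$ For each $t>0$ let $\nu_t$ be the (unique, finite, positive) Borel measure on $[0,\infty)$ with $g_t(z)=\int_0^\infty e^{-zs}\,\nu_t(ds)$ for $z>0$, and for $n\in\mathbb N=\{1,2,\dots\}$ let $g_t(tA/n)x:=\int_0^\infty e^{-s(t/n)A}x\,\nu_t(ds)$, $x\in X$, and $g_t^n(tA/n):=\bigl(g_t(tA/n)\bigr)^n$. Then for all $t>0$, $n\in\mathbb N$ and $x\in\operatorname{dom}(A^3)$, $$\Bigl\|g_t^n(tA/n)x-e^{-tA}x-\frac{g_t''(0)-1}{2n}\,t^2e^{-tA}A^2x\Bigr\|\le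 M\,C(g_t)\,t^3n^{-3/2}\,\|A^3x\|,\qquad C(g_t)=\Bigl(\frac{(g_t''(0)-1)(g_t''''(0)-1)}{2}\Bigr)^{1/2},$$ and for all $t>0$, $n\in\mathbb N$ and $x\in\operatorname{dom}(A^4)$, $$\Bigl\|g_t^n(tA/n)x-e^{-tA}x-\frac{g_t''(0)-1}{2n}\,t^2e^{-tA}A^2x\Bigr\|\le M\,\bigl(g_t''''(0)-1\bigr)\,t^3n^{-2}\,\bigl(\|A^3x\|+t\|A^4x\|\bigr).$$ -/

import Mathlib

open Set Filter Topology MeasureTheory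
open scoped NNReal ContDiff

/-- A `C₀`-semigroup `(T t)_{t ≥ 0}` of bounded linear operators on a complex normed space `X`. -/
structure C0Semigroup (X : Type*) [NormedAddCommGroup X] [NormedSpace ℂ X] where
  toFun : ℝ≥0 → X →L[ℂ] X
  map_zero : toFun 0 = ContinuousLinearMap.id ℂ X
  map_add : ∀ s t : ℝ≥0, toFun (s + t) = (toFun s).comp (toFun t)
  strongly_continuous : ∀ x : X, Continuous fun t : ℝ≥0 => toFun t x

namespace C0Semigroup

variable {X : Type*} [NormedAddCommGroup X] [NormedSpace ℂ X]

instance : CoeFun (C0Semigroup X) (fun _ => ℝ≥0 → X →L[ℂ] X) := ⟨toFun⟩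

/-- The semigroup is bounded: `sup_{t ≥ 0} ‖T t‖ < ∞`. -/
def IsBounded (T : C0Semigroup X) : Prop :=
  BddAbove (range fun t : ℝ≥0 => ‖T t‖)

/-- `M = sup_{t ≥ 0} ‖T t‖` (meaningful for bounded semigroups). -/
noncomputable def supNorm (T : C0Semigroup X) : ℝ :=
  ⨆ t : ℝ≥0, ‖T t‖

/-- `-A` is the (infinitesimal) generator of `T`, i.e. `T t = e^{-tA}`: the vector `x` lies in
`dom A` with `A x = y` if and only if `(x - T h x) / h → y` in norm as `h → 0+`. -/
def HasNegGenerator (T : C0Semigroup X) (A : X →ₗ.[ℂ] X) : Prop :=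
  ∀ x y : X, (x, y) ∈ A.graph ↔
    Tendsto (fun h : ℝ≥0 => (h : ℝ)⁻¹ • (x - T h x)) (𝓝[>] 0) (𝓝 y)

/-- The semigroup `s ↦ T (c s)`; if `T s = e^{-sA}`, this is `s ↦ e^{-s(cA)}`, the semigroup
whose generator is `-(cA)`. -/
def rescale (T : C0Semigroup X) (c : ℝ≥0) : C0Semigroup X where
  toFun s := T (c * s)
  map_zero := by rw [mul_zero]; exact T.map_zero
  map_add s t := by rw [mul_add]; exact T.map_add _ _
  strongly_continuous x := (T.strongly_continuous x).comp (continuous_const.mul continuous_id)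

end C0Semigroup

namespace LinearPMap

variable {X : Type*} [NormedAddCommGroup X] [NormedSpace ℂ X]

/-- The product `B A` of two unbounded operators on its natural domain
`{x ∈ dom A | A x ∈ dom B}`. -/
noncomputable def naturalComp (B A : X →ₗ.[ℂ] X) : X →ₗ.[ℂ] X :=
  B.comp (A.domRestrict ((B.domain.comap A.toFun).map A.domain.subtype)) (by
    rintro ⟨x, ⟨⟨u, hu, rfl⟩, hx⟩⟩
    exact hu)

/-- Powers `A ^ k` of an unbounded operator on their natural domains: `A ^ 0 = I` and
`dom (A ^ (k + 1)) = {x ∈ dom (A ^ k) | A ^ k x ∈ dom A}`. -/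
noncomputable def natPow (A : X →ₗ.[ℂ] X) : ℕ → X →ₗ.[ℂ] X
  | 0 => LinearMap.id.toPMap ⊤
  | k + 1 => A.naturalComp (A.natPow k)

theorem natPow_domain_succ_le (A : X →ₗ.[ℂ] X) (k : ℕ) :
    (A.natPow (k + 1)).domain ≤ (A.natPow k).domain :=
  inf_le_right

end LinearPMap

/-- Completely monotone functions on `(0, ∞)`; the values of `g` outside `(0, ∞)` are irrelevant. -/
structure IsCompletelyMonotone (g : ℝ → ℝ) : Prop where
  contDiffOn : ContDiffOn ℝ ∞ g (Ioi 0)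
  nonneg : ∀ k : ℕ, ∀ z : ℝ, 0 < z → 0 ≤ (-1 : ℝ) ^ k * iteratedDeriv k g z

/-- `g^{(k)}(0) = l`, where `g^{(k)}(0)` stands for `lim_{z → 0+} g^{(k)}(z)`
and this limit is the finite number `l`. -/
def DerivZeroEq (g : ℝ → ℝ) (k : ℕ) (l : ℝ) : Prop :=
  Tendsto (iteratedDeriv k g) (𝓝[>] 0) (𝓝 l)

/-- `ν` is a finite positive Borel measure on `[0, ∞)` with Laplace transform `g` on `(0, ∞)`. -/
def IsRepresentingMeasure (g : ℝ → ℝ) (ν : Measure ℝ≥0) : Prop :=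
  IsFiniteMeasure ν ∧ ∀ z : ℝ, 0 < z → g z = ∫ s : ℝ≥0, Real.exp (-(z * s)) ∂ν

open Classical in
/-- The representing measure of `g` (it is unique whenever it exists; it exists exactly when `g`
is bounded and completely monotone on `(0, ∞)`; otherwise the value `0` is a dummy). -/
noncomputable def representingMeasure (g : ℝ → ℝ) : Measure ℝ≥0 :=
  if h : ∃ ν : Measure ℝ≥0, IsRepresentingMeasure g ν then h.choose else 0

/-- The Hille-Phillips calculus: if `T s = e^{-sA}` is a bounded `C₀`-semigroup and `g` is a bounded
completely monotone function with representing measure `ν`, this is `x ↦ g(A) x = ∫ e^{-sA} x ν(ds)`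
(strong Bochner integral). -/
noncomputable def hillePhillips {X : Type*} [NormedAddCommGroup X] [NormedSpace ℂ X]
    (T : C0Semigroup X) (g : ℝ → ℝ) : X → X :=
  fun x => ∫ s : ℝ≥0, T s x ∂(representingMeasure g)

/-! The argument is a weak law of large numbers with moment bounds. By Bernstein's theorem `g t` is
the Laplace transform of a law `ν` on `[0, ∞)`; the values at `0+` say that `ν` has mass `1`, mean
`1`, variance `v = g₂ - 1` and a finite fourth moment. The semigroup law turns the `n`-th power of
the operator into `∫ T (t s / n) x` over the `n`-fold convolution `ν^{*n}`, the law of a sum `S` of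
`n` independent copies (`C0Semigroup.iterate_integral_orbit`).

Expand the orbit at time `t`, that is at `S = n`. The linear term has mean `0`, and the quadratic
one is the stated correction because `Var S = n v`. On `dom A³` the remainder is governed by `E|S -
n|³`, estimated by Cauchy–Schwarz between the second and fourth central moments. On `dom A⁴` the
cubic term and a remainder involving `E(S - n)⁴` are both of order `n⁻²`.

It remains to compare the central moments `m`, `k` of orders 3 and 4 of `ν` with `g₄ - 1 = k + 4m +
6v`. This rests on `m ≥ v² - v`, a consequence of `s ≥ 0`
(`HasCentralMoments.variance_sq_sub_le_third`). -/

/-! ### The Hausdorff moment problem on `[0, 1]`. -/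

section Bernstein

open scoped Polynomial unitInterval

/-- The linear functional on real polynomials sending `X ^ j` to `a j`. -/
noncomputable def momentFunctional (a : ℕ → ℝ) : ℝ[X] →ₗ[ℝ] ℝ :=
  Polynomial.lsum fun j => a j • LinearMap.id

theorem momentFunctional_apply (a : ℕ → ℝ) (p : ℝ[X]) :
    momentFunctional a p = p.sum fun j c => a j * c := by
  simp [momentFunctional, Polynomial.lsum_apply]

theorem momentFunctional_X_pow (a : ℕ → ℝ) (j : ℕ) :
    momentFunctional a (Polynomial.X ^ j) = a j := by
  rw [momentFunctional_apply, ← Polynomial.monomial_one_right_eq_X_pow,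
    Polynomial.sum_monomial_index] <;> simp

/-- Multiplication by `1 - X` is dual to the negated forward difference, so positivity on `X ^ k *
(1 - X) ^ m` is complete monotonicity of the sequence. -/
theorem momentFunctional_one_sub_X_mul (a : ℕ → ℝ) (p : ℝ[X]) :
    momentFunctional a ((1 - Polynomial.X) * p)
      = momentFunctional (fun j => a j - a (j + 1)) p := by
  induction p using Polynomial.induction_on' with
  | add p q hp hq => rw [mul_add, map_add, map_add, hp, hq]
  | monomial n c =>
    have : (1 - Polynomial.X) * Polynomial.monomial n c
        = c • (Polynomial.X ^ n - Polynomial.X ^ (n + 1) : ℝ[X]) := by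
      rw [← Polynomial.C_mul_X_pow_eq_monomial, Polynomial.smul_eq_C_mul]; ring
    rw [this, ← Polynomial.C_mul_X_pow_eq_monomial, ← Polynomial.smul_eq_C_mul, map_smul, map_smul,
      map_sub, momentFunctional_X_pow, momentFunctional_X_pow, momentFunctional_X_pow]

/-- Bernstein sums reproduce binomial coefficients exactly: `C(n,k) C(k,j) = C(n,j) C(n-j,k-j)`
leaves a partition of unity of degree `n - j`. -/
theorem bernsteinPolynomial_sum_choose (n j : ℕ) :
    ∑ k ∈ Finset.range (n + 1), (k.choose j : ℝ) • bernsteinPolynomial ℝ n k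
      = (n.choose j : ℝ) • (Polynomial.X ^ j : ℝ[X]) := by
  rcases lt_or_ge n j with h | h
  · rw [Nat.choose_eq_zero_of_lt h, Finset.sum_eq_zero]
    · simp
    · intro k hk
      rw [Nat.choose_eq_zero_of_lt (by have := Finset.mem_range.1 hk; omega)]; simp
  · obtain ⟨m, rfl⟩ := Nat.exists_eq_add_of_le h
    rw [add_assoc, Finset.sum_range_add, Finset.sum_eq_zero, zero_add]
    · have key : ∀ i ∈ Finset.range (m + 1),
          ((j + i).choose j : ℝ) • bernsteinPolynomial ℝ (j + m) (j + i)
          = ((j + m).choose j : ℝ) • (Polynomial.X ^ j * bernsteinPolynomial ℝ m i) := by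
        intro i hi
        have hc : ((j + m).choose (j + i) * (j + i).choose j : ℕ)
            = (j + m).choose j * m.choose i := by
          rw [Nat.choose_mul (Nat.le_add_right j i)]; simp
        have hc' : (((j + i).choose j : ℕ) : ℝ[X]) * ((j + m).choose (j + i) : ℕ)
            = ((j + m).choose j : ℕ) * (m.choose i : ℕ) := by
          rw [mul_comm]; exact_mod_cast hc
        simp only [bernsteinPolynomial, Polynomial.smul_eq_C_mul, map_natCast]
        rw [show j + m - (j + i) = m - i by omega, pow_add]
        linear_combination (Polynomial.X ^ j * Polynomial.X ^ i * (1 - Polynomial.X) ^ (m - i)) * hc'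
      rw [Finset.sum_congr rfl key, ← Finset.smul_sum, ← Finset.mul_sum,
        bernsteinPolynomial.sum, mul_one]
    · intro k hk
      rw [Nat.choose_eq_zero_of_lt (Finset.mem_range.1 hk)]; simp

/-- Passing from `j` to `j + 1` costs at most `j / n`, uniformly in `k`; these errors add up to at
most `j² / n`. -/
theorem abs_descFactorial_div_pow_sub_le {n k : ℕ} (hn : 0 < n) (hk : k ≤ n) (j : ℕ) :
    |(k.descFactorial j : ℝ) / (n : ℝ) ^ j - ((k : ℝ) / n) ^ j| ≤ (j : ℝ) ^ 2 / n := by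
  have hn' : (0 : ℝ) < n := by exact_mod_cast hn
  have hkn : (k : ℝ) / n ≤ 1 := div_le_one_of_le₀ (by exact_mod_cast hk) hn'.le
  have hkn0 : 0 ≤ (k : ℝ) / n := by positivity
  induction j with
  | zero => simp
  | succ j ih =>
    have hD : ((k.descFactorial (j + 1) : ℕ) : ℝ) = (k - j) * k.descFactorial j := by
      rw [Nat.descFactorial_succ]
      rcases lt_or_ge k j with h | h
      · rw [Nat.descFactorial_eq_zero_iff_lt.2 h]; simp
      · push_cast [h]; ring
    set D : ℝ := k.descFactorial j / (n : ℝ) ^ j with hDdef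
    have hD0 : 0 ≤ D := by positivity
    have hD1 : D ≤ 1 := by
      refine div_le_one_of_le₀ ?_ (by positivity)
      exact_mod_cast (Nat.descFactorial_le_pow k j).trans (Nat.pow_le_pow_left hk j)
    have e : ((k.descFactorial (j + 1) : ℕ) : ℝ) / (n : ℝ) ^ (j + 1) - ((k : ℝ) / n) ^ (j + 1)
        = (k : ℝ) / n * (D - ((k : ℝ) / n) ^ j) - j / n * D := by
      rw [hD, hDdef, pow_succ, pow_succ]; generalize ((k : ℝ) / n) ^ j = q; field_simp; ring
    rw [e]
    have h1 : |(k : ℝ) / n * (D - ((k : ℝ) / n) ^ j)| ≤ 1 * ((j : ℝ) ^ 2 / n) := by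
      rw [abs_mul, abs_of_nonneg hkn0]
      exact mul_le_mul hkn ih (abs_nonneg _) zero_le_one
    have h2 : |(j : ℝ) / n * D| ≤ j / n * 1 := by
      rw [abs_of_nonneg (by positivity)]
      gcongr
    calc _ ≤ _ := abs_sub _ _
      _ ≤ 1 * ((j : ℝ) ^ 2 / n) + j / n * 1 := add_le_add h1 h2
      _ = ((j : ℝ) ^ 2 + j) / n := by ring
      _ ≤ _ := by
        gcongr; push_cast; nlinarith [(Nat.cast_nonneg j : (0 : ℝ) ≤ j)]

/-- Place at `k / n` the mass that the functional gives to the `k`-th Bernstein polynomial.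
Factorial moments then come out exactly, and ordinary moments differ from them by `O(1/n)`. -/
theorem exists_probabilityMeasure_abs_moment_sub_le (a : ℕ → ℝ) (ha0 : a 0 = 1)
    (ha : ∀ k m : ℕ, 0 ≤ momentFunctional a (Polynomial.X ^ k * (1 - Polynomial.X) ^ m))
    {n : ℕ} (hn : 0 < n) :
    ∃ P : ProbabilityMeasure I, ∀ j : ℕ,
      |∫ x : I, (x : ℝ) ^ j ∂(P : Measure I) - a j| ≤ (1 + |a j|) * ((j : ℝ) ^ 2 / n) := by
  have hn' : (0 : ℝ) < n := by exact_mod_cast hn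
  set w : Fin (n + 1) → ℝ := fun k => momentFunctional a (bernsteinPolynomial ℝ n k) with hw
  have hw0 : ∀ k, 0 ≤ w k := by
    intro k
    have : bernsteinPolynomial ℝ n k
        = (n.choose k : ℝ) • (Polynomial.X ^ (k : ℕ) * (1 - Polynomial.X) ^ (n - k)) := by
      simp only [bernsteinPolynomial, Polynomial.smul_eq_C_mul, map_natCast]; ring
    simp only [hw]
    rw [this, map_smul, smul_eq_mul]
    exact mul_nonneg (Nat.cast_nonneg _) (ha _ _)
  have hw_choose : ∀ j, ∑ k, w k * ((k : ℕ).choose j : ℝ) = n.choose j * a j := by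
    intro j
    have := congrArg (momentFunctional a) (bernsteinPolynomial_sum_choose n j)
    rw [map_sum, map_smul, momentFunctional_X_pow, smul_eq_mul, Finset.sum_range] at this
    rw [← this]
    refine Finset.sum_congr rfl fun k _ => ?_
    rw [map_smul, smul_eq_mul, mul_comm]
  have hw1 : ∑ k, w k = 1 := by simpa [ha0] using hw_choose 0
  have hw_desc : ∀ j, ∑ k, w k * ((k : ℕ).descFactorial j : ℝ) = n.descFactorial j * a j := by
    intro j
    simp only [Nat.descFactorial_eq_factorial_mul_choose, Nat.cast_mul]
    rw [mul_assoc, ← hw_choose, Finset.mul_sum]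
    exact Finset.sum_congr rfl fun k _ => by ring
  set μ : Measure I := ∑ k, ENNReal.ofReal (w k) • Measure.dirac (bernstein.z k) with hμ
  have hμ1 : IsProbabilityMeasure μ := by
    constructor
    simp only [hμ, Measure.coe_finsetSum, Finset.sum_apply, Measure.smul_apply, measure_univ,
      smul_eq_mul, mul_one]
    rw [← ENNReal.ofReal_sum_of_nonneg fun k _ => hw0 k, hw1, ENNReal.ofReal_one]
  refine ⟨⟨μ, hμ1⟩, fun j => ?_⟩
  have hint : ∫ x : I, (x : ℝ) ^ j ∂μ = ∑ k : Fin (n + 1), w k * ((k : ℝ) / n) ^ j := by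
    rw [hμ, integral_finsetSum_measure]
    · refine Finset.sum_congr rfl fun k _ => ?_
      rw [integral_smul_measure, integral_dirac, ENNReal.toReal_ofReal (hw0 k)]
      rfl
    · intro k _
      exact (integrable_dirac (by simp)).smul_measure ENNReal.ofReal_ne_top
  change |∫ x : I, (x : ℝ) ^ j ∂μ - a j| ≤ _
  have e : ∫ x : I, (x : ℝ) ^ j ∂μ - a j
      = a j * ((n.descFactorial j : ℝ) / (n : ℝ) ^ j - ((n : ℝ) / n) ^ j)
        - ∑ k, w k * (((k : ℕ).descFactorial j : ℝ) / (n : ℝ) ^ j - (((k : ℕ) : ℝ) / n) ^ j) := by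
    have := hw_desc j
    rw [hint, div_self hn'.ne', one_pow]
    simp only [mul_sub, Finset.sum_sub_distrib]
    simp only [← mul_div_assoc, ← Finset.sum_div]
    rw [this]; ring
  rw [e]
  have h1 : |a j * ((n.descFactorial j : ℝ) / (n : ℝ) ^ j - ((n : ℝ) / n) ^ j)|
      ≤ |a j| * ((j : ℝ) ^ 2 / n) := by
    rw [abs_mul]
    exact mul_le_mul_of_nonneg_left (abs_descFactorial_div_pow_sub_le hn le_rfl j) (abs_nonneg _)
  have h2 : |∑ k, w k * (((k : ℕ).descFactorial j : ℝ) / (n : ℝ) ^ j - (((k : ℕ) : ℝ) / n) ^ j)|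
      ≤ ∑ k, w k * ((j : ℝ) ^ 2 / n) := by
    refine (Finset.abs_sum_le_sum_abs _ _).trans (Finset.sum_le_sum fun k _ => ?_)
    rw [abs_mul, abs_of_nonneg (hw0 k)]
    exact mul_le_mul_of_nonneg_left
      (abs_descFactorial_div_pow_sub_le hn (Nat.lt_succ_iff.1 k.2) j) (hw0 k)
  rw [← Finset.sum_mul, hw1] at h2
  calc _ ≤ _ := abs_sub _ _
    _ ≤ _ := add_le_add h1 h2
    _ = _ := by ring

/-- Every sequence of probability measures on `[0, 1]` has a cluster point along the
hyperfilter. -/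
theorem exists_tendsto_hyperfilter (P : ℕ → ProbabilityMeasure I) :
    ∃ Q : ProbabilityMeasure I, ∀ f : C(I, ℝ),
      Tendsto (fun n => ∫ x, f x ∂(P n : Measure I)) (hyperfilter ℕ : Filter ℕ)
        (𝓝 (∫ x, f x ∂(Q : Measure I))) := by
  -- Probability measures on the compact `I` form a compact space, so the image ultrafilter
  -- converges.
  refine ⟨((hyperfilter ℕ).map P).lim, fun f => ?_⟩
  have h : Tendsto P (hyperfilter ℕ : Filter ℕ) (𝓝 ((hyperfilter ℕ).map P).lim) :=
    ((hyperfilter ℕ).map P).le_nhds_lim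
  exact ProbabilityMeasure.tendsto_iff_forall_integral_tendsto.1 h
    (BoundedContinuousFunction.mkOfCompact f)

/-- The Hausdorff moment problem. -/
theorem exists_probabilityMeasure_moment_eq (a : ℕ → ℝ) (ha0 : a 0 = 1)
    (ha : ∀ k m : ℕ, 0 ≤ momentFunctional a (Polynomial.X ^ k * (1 - Polynomial.X) ^ m)) :
    ∃ P : ProbabilityMeasure I, ∀ j : ℕ, ∫ x : I, (x : ℝ) ^ j ∂(P : Measure I) = a j := by
  choose P hP using fun n : ℕ => exists_probabilityMeasure_abs_moment_sub_le a ha0 ha n.succ_pos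
  obtain ⟨Q, hQ⟩ := exists_tendsto_hyperfilter P
  refine ⟨Q, fun j => ?_⟩
  refine tendsto_nhds_unique (hQ ⟨fun x => (x : ℝ) ^ j, by fun_prop⟩) ?_
  refine Tendsto.mono_left ?_ Nat.hyperfilter_le_atTop
  rw [tendsto_iff_dist_tendsto_zero]
  refine squeeze_zero (fun _ => dist_nonneg) (fun n => hP n j) ?_
  have h := (tendsto_const_div_atTop_nhds_zero_nat ((j : ℝ) ^ 2)).comp (tendsto_add_atTop_nat 1)
  simpa using h.const_mul (1 + |a j|)

/-! ### Bernstein's theorem for completely monotone functions. -/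

namespace IsCompletelyMonotone

variable {g : ℝ → ℝ}

theorem contDiffAt (hg : IsCompletelyMonotone g) {z : ℝ} (hz : 0 < z) (k : ℕ) :
    ContDiffAt ℝ k g z :=
  (hg.contDiffOn.contDiffAt (Ioi_mem_nhds hz)).of_le (by exact_mod_cast le_top)

theorem differentiableAt_iteratedDeriv (hg : IsCompletelyMonotone g) {z : ℝ} (hz : 0 < z)
    (k : ℕ) : DifferentiableAt ℝ (iteratedDeriv k g) z := by
  have h := hg.contDiffOn.differentiableOn_iteratedDerivWithin (m := k)
    (by exact_mod_cast WithTop.coe_lt_top _) isOpen_Ioi.uniqueDiffOn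
  refine (h.differentiableAt (Ioi_mem_nhds hz)).congr_of_eventuallyEq ?_
  filter_upwards [Ioi_mem_nhds hz] with y hy
  exact (iteratedDerivWithin_of_isOpen isOpen_Ioi hy).symm

theorem antitoneOn_iteratedDeriv (hg : IsCompletelyMonotone g) (k : ℕ) :
    AntitoneOn (fun z => (-1 : ℝ) ^ k * iteratedDeriv k g z) (Ioi 0) := by
  have hd : ∀ z : ℝ, 0 < z → DifferentiableAt ℝ (fun z => (-1 : ℝ) ^ k * iteratedDeriv k g z) z :=
    fun z hz => (hg.differentiableAt_iteratedDeriv hz k).const_mul _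
  refine antitoneOn_of_deriv_nonpos (convex_Ioi 0)
    (fun z hz => (hd z hz).continuousAt.continuousWithinAt) ?_ ?_
  · rw [interior_Ioi]; exact fun z hz => (hd z hz).differentiableWithinAt
  · rw [interior_Ioi]
    intro z hz
    rw [deriv_const_mul _ (hg.differentiableAt_iteratedDeriv hz k), ← iteratedDeriv_succ]
    have := hg.nonneg (k + 1) z hz
    rw [pow_succ] at this
    linarith

theorem sub_comp_add_const (hg : IsCompletelyMonotone g) {h : ℝ} (hh : 0 < h) :
    IsCompletelyMonotone fun z => g z - g (z + h) where
  contDiffOn := hg.contDiffOn.sub <| hg.contDiffOn.comp (by fun_prop) fun z hz =>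
    mem_Ioi.2 (add_pos (mem_Ioi.1 hz) hh)
  nonneg k z hz := by
    have h1 : ContDiffAt ℝ k (fun z => g (z + h)) z :=
      (hg.contDiffAt (add_pos hz hh) k).comp z (by fun_prop)
    rw [iteratedDeriv_fun_sub (hg.contDiffAt hz k) h1, iteratedDeriv_comp_add_const, mul_sub]
    have := hg.antitoneOn_iteratedDeriv k (mem_Ioi.2 hz) (mem_Ioi.2 (add_pos hz hh))
      (by linarith : z ≤ z + h)
    simpa using this

/-- Each factor `1 - X` replaces `g` by `g - g (· + h)`, which is again completely monotone; hence
the induction on `m` with `g` varying. -/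
theorem momentFunctional_nonneg (hg : IsCompletelyMonotone g) {h z : ℝ} (hh : 0 < h) (hz : 0 < z)
    (k m : ℕ) :
    0 ≤ momentFunctional (fun i => g (z + i * h)) (Polynomial.X ^ k * (1 - Polynomial.X) ^ m) := by
  induction m generalizing g with
  | zero =>
    have := hg.nonneg 0 (z + k * h) (by positivity)
    simpa [momentFunctional_X_pow] using this
  | succ m ih =>
    rw [show (Polynomial.X ^ k * (1 - Polynomial.X) ^ (m + 1) : ℝ[X])
      = (1 - Polynomial.X) * (Polynomial.X ^ k * (1 - Polynomial.X) ^ m) by ring,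
      momentFunctional_one_sub_X_mul]
    convert ih (hg.sub_comp_add_const hh) using 5
    push_cast; ring_nf

theorem continuousAt (hg : IsCompletelyMonotone g) {z : ℝ} (hz : 0 < z) : ContinuousAt g z :=
  (hg.contDiffAt hz 0).continuousAt

/-- The value `g 0` is arbitrary, so the limit at `0+` stands in for it; positivity survives letting
`z → 0+`. -/
theorem momentFunctional_update_nonneg (hg : IsCompletelyMonotone g) {l : ℝ}
    (h0 : Tendsto g (𝓝[>] 0) (𝓝 l)) {h : ℝ} (hh : 0 < h) (k m : ℕ) :
    0 ≤ momentFunctional (fun i => if i = 0 then l else g (i * h))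
      (Polynomial.X ^ k * (1 - Polynomial.X) ^ m) := by
  refine ge_of_tendsto (f := fun z => momentFunctional (fun i => g (z + i * h))
    (Polynomial.X ^ k * (1 - Polynomial.X) ^ m)) (x := 𝓝[>] 0) ?_ ?_
  · simp only [momentFunctional_apply, Polynomial.sum]
    refine tendsto_finsetSum _ fun i _ => Tendsto.mul_const _ ?_
    rcases Nat.eq_zero_or_pos i with rfl | hi
    · simpa using h0
    · rw [if_neg hi.ne']
      have hp : 0 < i * h := by positivity
      have hc : ContinuousAt (fun z => g (z + i * h)) 0 :=
        ContinuousAt.comp (f := fun z => z + i * h) (by simpa using hg.continuousAt hp)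
          (by fun_prop)
      have := hc.tendsto
      simp only [zero_add] at this
      exact this.mono_left nhdsWithin_le_nhds
  · filter_upwards [self_mem_nhdsWithin] with z hz
    exact hg.momentFunctional_nonneg hh hz k m

theorem exists_measure_integral_pow_eq (hg : IsCompletelyMonotone g)
    (h0 : Tendsto g (𝓝[>] 0) (𝓝 1)) {N : ℕ} (hN : 0 < N) :
    ∃ P : ProbabilityMeasure I, ∀ j : ℕ, 0 < j →
      ∫ x : I, (x : ℝ) ^ ((j : ℝ) / N) ∂(P : Measure I) = g (j / N) := by
  have hN' : (0 : ℝ) < N := by exact_mod_cast hN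
  obtain ⟨P, hP⟩ := exists_probabilityMeasure_moment_eq
    (fun i : ℕ => if i = 0 then 1 else g (i * (1 / N : ℝ))) (by simp)
    (hg.momentFunctional_update_nonneg h0 (by positivity))
  -- The image under `x ↦ x ^ N` makes the exponent `j / N` match the sample point, so measures for
  -- different `N` become comparable.
  have hc : Continuous fun x : I => x ^ N := by fun_prop
  refine ⟨P.map hc.measurable.aemeasurable, fun j hj => ?_⟩
  rw [ProbabilityMeasure.toMeasure_map, integral_map hc.measurable.aemeasurable]
  · rw [← mul_one_div, show g (j * (1 / N)) = _ from (if_neg hj.ne').symm, ← hP j]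
    refine integral_congr_ae (Eventually.of_forall fun x => ?_)
    change ((x ^ N : I) : ℝ) ^ ((j : ℝ) * (1 / N)) = (x : ℝ) ^ j
    rw [show ((x ^ N : I) : ℝ) = (x : ℝ) ^ N from rfl, ← Real.rpow_natCast, ← Real.rpow_mul x.2.1,
      ← Real.rpow_natCast]
    congr 1
    field_simp
  · exact (Continuous.rpow_const continuous_subtype_val
      (fun _ => Or.inr (by positivity))).aestronglyMeasurable

end IsCompletelyMonotone

theorem continuousOn_integral_rpow (P : Measure I) [IsFiniteMeasure P] :
    ContinuousOn (fun z : ℝ => ∫ x : I, (x : ℝ) ^ z ∂P) (Ioi 0) := by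
  refine continuousOn_of_dominated (bound := fun _ => 1) ?_ ?_ (integrable_const 1) ?_
  · intro z hz
    exact (Continuous.rpow_const continuous_subtype_val
      (fun _ => Or.inr (mem_Ioi.1 hz).le)).aestronglyMeasurable
  · refine fun z hz => Eventually.of_forall fun x => ?_
    rw [Real.norm_of_nonneg (Real.rpow_nonneg x.2.1 _)]
    exact Real.rpow_le_one x.2.1 x.2.2 (mem_Ioi.1 hz).le
  · exact Eventually.of_forall fun x z hz =>
      (Real.continuousAt_const_rpow' (mem_Ioi.1 hz).ne').continuousWithinAt

namespace IsCompletelyMonotone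

variable {g : ℝ → ℝ}

/-- Factorial denominators make every positive rational an admissible exponent from some `N` on. The
limit measure is right at rationals, and continuity does the rest. -/
theorem exists_measure_integral_rpow_eq (hg : IsCompletelyMonotone g)
    (h0 : Tendsto g (𝓝[>] 0) (𝓝 1)) :
    ∃ P : ProbabilityMeasure I, ∀ z : ℝ, 0 < z →
      ∫ x : I, (x : ℝ) ^ z ∂(P : Measure I) = g z := by
  choose P hP using fun N : ℕ => hg.exists_measure_integral_pow_eq h0 N.factorial_pos
  obtain ⟨Q, hQ⟩ := exists_tendsto_hyperfilter P
  refine ⟨Q, ?_⟩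
  have hrat : EqOn (fun z : ℝ => ∫ x : I, (x : ℝ) ^ z ∂(Q : Measure I)) g
      (Ioi 0 ∩ range ((↑) : ℚ → ℝ)) := by
    rintro _ ⟨hq, q, rfl⟩
    have hq0 : (0 : ℝ) < q := hq
    have hq0' : 0 < q := by exact_mod_cast hq0
    refine tendsto_nhds_unique
      (hQ ⟨fun x => (x : ℝ) ^ (q : ℝ), Continuous.rpow_const continuous_subtype_val
        (fun _ => Or.inr hq0.le)⟩) ?_
    refine Tendsto.mono_left ?_ Nat.hyperfilter_le_atTop
    refine tendsto_const_nhds.congr' ?_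
    filter_upwards [eventually_ge_atTop q.den] with N hN
    obtain ⟨d, hd⟩ := Nat.dvd_factorial q.den_pos hN
    have hd0 : 0 < d := Nat.pos_of_mul_pos_left (hd ▸ N.factorial_pos)
    obtain ⟨a, ha⟩ := Int.eq_ofNat_of_zero_le (Rat.num_pos.2 hq0').le
    have ha0 : 0 < a := by have := Rat.num_pos.2 hq0'; omega
    have hqe : (q : ℝ) = ((a * d : ℕ) : ℝ) / (N.factorial : ℕ) := by
      rw [hd, Rat.cast_def, ha]
      have : (0 : ℝ) < q.den := by exact_mod_cast q.den_pos
      have : (0 : ℝ) < d := by exact_mod_cast hd0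
      push_cast; field_simp
    change g q = ∫ x : I, (x : ℝ) ^ (q : ℝ) ∂(P N : Measure I)
    rw [hqe, hP N _ (Nat.mul_pos ha0 hd0)]
  have hcl := EqOn.of_subset_closure hrat (continuousOn_integral_rpow (Q : Measure I))
    (fun z hz => (hg.continuousAt hz).continuousWithinAt) inter_subset_left
    (Rat.denseRange_cast.open_subset_closure_inter isOpen_Ioi)
  exact fun z hz => hcl hz

/-- **Bernstein's theorem** for completely monotone functions with value `1` at `0+`. -/
theorem exists_isRepresentingMeasure (hg : IsCompletelyMonotone g)
    (h0 : Tendsto g (𝓝[>] 0) (𝓝 1)) : ∃ ν : Measure ℝ≥0, IsRepresentingMeasure g ν := by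
  obtain ⟨P, hP⟩ := hg.exists_measure_integral_rpow_eq h0
  -- An atom at `0` would be mass at `s = ∞`. It is excluded since `x ^ (1/(n+1))` tends to the
  -- indicator of `x ≠ 0` while its integral `g (1/(n+1))` tends to `1`.
  have hpos : ∀ᵐ x : I ∂(P : Measure I), x ≠ 0 := by
    have h1 : Tendsto (fun n : ℕ => ∫ x : I, (x : ℝ) ^ (1 / ((n : ℝ) + 1)) ∂(P : Measure I)) atTop
        (𝓝 (∫ x : I, ({0}ᶜ : Set I).indicator (fun _ => (1 : ℝ)) x ∂(P : Measure I))) := by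
      refine tendsto_integral_of_dominated_convergence (fun _ => 1) ?_ (integrable_const 1) ?_ ?_
      · intro n
        exact (Continuous.rpow_const continuous_subtype_val
          (fun _ => Or.inr (by positivity))).aestronglyMeasurable
      · refine fun n => Eventually.of_forall fun x => ?_
        rw [Real.norm_of_nonneg (Real.rpow_nonneg x.2.1 _)]
        exact Real.rpow_le_one x.2.1 x.2.2 (by positivity)
      · refine Eventually.of_forall fun x => ?_
        by_cases hx : x = 0
        · subst hx
          simp only [mem_compl_iff, mem_singleton_iff, not_true_eq_false, not_false_eq_true,
            indicator_of_notMem]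
          refine tendsto_const_nhds.congr fun n => ?_
          rw [Icc.coe_zero, Real.zero_rpow (by positivity)]
        · have hx' : (x : ℝ) ≠ 0 := fun h => hx (Subtype.ext h)
          rw [indicator_of_mem (by simpa using hx)]
          have := (Real.continuousAt_const_rpow (b := 0) hx').tendsto.comp
            tendsto_one_div_add_atTop_nhds_zero_nat
          simpa [Function.comp_def] using this
    have h2 : Tendsto (fun n : ℕ => ∫ x : I, (x : ℝ) ^ (1 / ((n : ℝ) + 1)) ∂(P : Measure I)) atTop
        (𝓝 1) := by
      have h3 : Tendsto (fun n : ℕ => 1 / ((n : ℝ) + 1)) atTop (𝓝[>] 0) :=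
        tendsto_nhdsWithin_iff.2 ⟨tendsto_one_div_add_atTop_nhds_zero_nat,
          Eventually.of_forall fun n => mem_Ioi.2 (by positivity)⟩
      refine (h0.comp h3).congr fun n => ?_
      rw [hP _ (by positivity)]; rfl
    have h3 := tendsto_nhds_unique h1 h2
    rw [integral_indicator_const _ (by measurability), smul_eq_mul, mul_one] at h3
    rw [ae_iff]
    have : {a : I | ¬ a ≠ 0} = ({0}ᶜ : Set I)ᶜ := by ext; simp
    rw [this, prob_compl_eq_zero_iff (by measurability)]
    rwa [Measure.real, ENNReal.toReal_eq_one_iff] at h3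
  -- The substitution `s = -log x` turns `x ^ z` into `e^{-zs}`.
  have hm : Measurable fun x : I => Real.toNNReal (-Real.log (x : ℝ)) := by fun_prop
  refine ⟨(P : Measure I).map fun x : I => Real.toNNReal (-Real.log (x : ℝ)), ?_, fun z hz => ?_⟩
  · exact Measure.isFiniteMeasure_map _ _
  · rw [integral_map hm.aemeasurable (by fun_prop), ← hP z hz]
    refine integral_congr_ae ?_
    filter_upwards [hpos] with x hx
    have hx' : 0 < (x : ℝ) := lt_of_le_of_ne x.2.1 fun h => hx (Subtype.ext h.symm)
    rw [Real.coe_toNNReal _ (neg_nonneg.2 (Real.log_nonpos x.2.1 x.2.2)),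
      Real.rpow_def_of_pos hx']
    ring_nf

end IsCompletelyMonotone

end Bernstein

/-! ### Moments of the representing measure from derivatives at `0+`. -/

namespace IsRepresentingMeasure

variable {g : ℝ → ℝ} {ν : Measure ℝ≥0}

theorem integrable_exp (hν : IsRepresentingMeasure g ν) {t : ℝ} (ht : t ≤ 0) :
    Integrable (fun s : ℝ≥0 => Real.exp (t * s)) ν := by
  have := hν.1
  refine Integrable.of_bound (by fun_prop) 1 (Eventually.of_forall fun s => ?_)
  rw [Real.norm_of_nonneg (Real.exp_pos _).le]
  exact Real.exp_le_one_iff.2 (mul_nonpos_of_nonpos_of_nonneg ht s.2)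

theorem neg_mem_interior (hν : IsRepresentingMeasure g ν) {z : ℝ} (hz : 0 < z) :
    -z ∈ interior (ProbabilityTheory.integrableExpSet (fun s : ℝ≥0 => (s : ℝ)) ν) := by
  have : Iio (0 : ℝ) ⊆ ProbabilityTheory.integrableExpSet (fun s : ℝ≥0 => (s : ℝ)) ν :=
    fun t ht => hν.integrable_exp (le_of_lt ht)
  exact interior_maximal this isOpen_Iio (neg_lt_zero.2 hz)

theorem integrable_pow_mul_exp (hν : IsRepresentingMeasure g ν) {z : ℝ} (hz : 0 < z) (k : ℕ) :
    Integrable (fun s : ℝ≥0 => (s : ℝ) ^ k * Real.exp (-z * s)) ν :=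
  ProbabilityTheory.integrable_pow_mul_exp_of_mem_interior_integrableExpSet
    (hν.neg_mem_interior hz) k

theorem iteratedDeriv_eq (hν : IsRepresentingMeasure g ν) {z : ℝ} (hz : 0 < z) (k : ℕ) :
    iteratedDeriv k g z = (-1) ^ k * ∫ s : ℝ≥0, (s : ℝ) ^ k * Real.exp (-z * s) ∂ν := by
  have hg : g =ᶠ[𝓝 z] fun y => ProbabilityTheory.mgf (fun s : ℝ≥0 => (s : ℝ)) ν (-y) := by
    filter_upwards [Ioi_mem_nhds hz] with y hy
    rw [hν.2 y hy, ProbabilityTheory.mgf]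
    simp only [neg_mul]
  rw [hg.iteratedDeriv_eq, iteratedDeriv_comp_neg,
    ProbabilityTheory.iteratedDeriv_mgf (hν.neg_mem_interior hz), smul_eq_mul]

/-- As `z ↓ 0`, `s ^ k * e^{-zs}` increases to `s ^ k`, so monotone convergence applies. Working in
`ENNReal` presupposes no integrability; a finite `l` yields it. -/
theorem lintegral_pow_eq (hν : IsRepresentingMeasure g ν) {k : ℕ} {l : ℝ}
    (hl : DerivZeroEq g k l) :
    ∫⁻ s : ℝ≥0, ENNReal.ofReal ((s : ℝ) ^ k) ∂ν = ENNReal.ofReal ((-1) ^ k * l) := by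
  have hz : Tendsto (fun n : ℕ => 1 / ((n : ℝ) + 1)) atTop (𝓝[>] 0) :=
    tendsto_nhdsWithin_iff.2 ⟨tendsto_one_div_add_atTop_nhds_zero_nat,
      Eventually.of_forall fun n => mem_Ioi.2 (by positivity)⟩
  have h1 : Tendsto (fun n : ℕ => ENNReal.ofReal
      (∫ s : ℝ≥0, (s : ℝ) ^ k * Real.exp (-(1 / ((n : ℝ) + 1)) * s) ∂ν)) atTop
      (𝓝 (ENNReal.ofReal ((-1) ^ k * l))) := by
    refine (ENNReal.continuous_ofReal.tendsto _).comp ?_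
    refine ((hl.comp hz).const_mul ((-1) ^ k)).congr fun n => ?_
    rw [Function.comp_apply, hν.iteratedDeriv_eq (by positivity), ← mul_assoc, ← mul_pow]
    norm_num
  have h2 : Tendsto (fun n : ℕ => ∫⁻ s : ℝ≥0, ENNReal.ofReal
      ((s : ℝ) ^ k * Real.exp (-(1 / ((n : ℝ) + 1)) * s)) ∂ν) atTop
      (𝓝 (∫⁻ s : ℝ≥0, ENNReal.ofReal ((s : ℝ) ^ k) ∂ν)) := by
    refine lintegral_tendsto_of_tendsto_of_monotone (fun n => by fun_prop) ?_ ?_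
    · refine Eventually.of_forall fun s m n hmn => ENNReal.ofReal_le_ofReal ?_
      have : (m : ℝ) ≤ n := by exact_mod_cast hmn
      have hs : (0 : ℝ) ≤ s := s.2
      gcongr
    · refine Eventually.of_forall fun s => (ENNReal.continuous_ofReal.tendsto _).comp ?_
      have h3 : Continuous fun z : ℝ => (s : ℝ) ^ k * Real.exp (-z * s) := by fun_prop
      have := (h3.tendsto 0).comp tendsto_one_div_add_atTop_nhds_zero_nat
      simpa [Function.comp_def] using this
  refine tendsto_nhds_unique h2 (h1.congr fun n => ?_)
  exact ofReal_integral_eq_lintegral_ofReal (hν.integrable_pow_mul_exp (by positivity) k)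
    (Eventually.of_forall fun s => mul_nonneg (pow_nonneg s.2 k) (Real.exp_pos _).le)

theorem integrable_pow (hν : IsRepresentingMeasure g ν) {k : ℕ} {l : ℝ}
    (hl : DerivZeroEq g k l) : Integrable (fun s : ℝ≥0 => (s : ℝ) ^ k) ν := by
  refine (lintegral_ofReal_ne_top_iff_integrable (by fun_prop)
    (Eventually.of_forall fun s => pow_nonneg s.2 k)).1 ?_
  rw [hν.lintegral_pow_eq hl]
  exact ENNReal.ofReal_ne_top

theorem integral_pow_eq (hν : IsRepresentingMeasure g ν) (hg : IsCompletelyMonotone g) {k : ℕ}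
    {l : ℝ} (hl : DerivZeroEq g k l) : ∫ s : ℝ≥0, (s : ℝ) ^ k ∂ν = (-1) ^ k * l := by
  rw [integral_eq_lintegral_of_nonneg_ae (Eventually.of_forall fun s => pow_nonneg s.2 k)
    (by fun_prop), hν.lintegral_pow_eq hl, ENNReal.toReal_ofReal]
  refine ge_of_tendsto (hl.const_mul _) ?_
  filter_upwards [self_mem_nhdsWithin] with z hz
  exact hg.nonneg k z hz

end IsRepresentingMeasure

/-! ### Central moments and their behaviour under convolution. -/

theorem integrable_sub_pow {μ : Measure ℝ≥0} [IsFiniteMeasure μ]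
    (h : Integrable (fun s : ℝ≥0 => (s : ℝ) ^ 4) μ) (b : ℝ) {j : ℕ} (hj : j ≤ 4) :
    Integrable (fun s : ℝ≥0 => ((s : ℝ) - b) ^ j) μ := by
  refine ((h.const_mul 8).add (integrable_const (1 + 8 * b ^ 4))).mono' (by fun_prop)
    (Eventually.of_forall fun s => ?_)
  have h1 : ‖((s : ℝ) - b) ^ j‖ ≤ 1 + ((s : ℝ) - b) ^ 4 := by
    rw [norm_pow, Real.norm_eq_abs, ← Even.pow_abs (by decide : Even 4) ((s : ℝ) - b)]
    rcases le_total |(s : ℝ) - b| 1 with h | h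
    · exact (pow_le_one₀ (abs_nonneg _) h).trans
        (by linarith [pow_nonneg (abs_nonneg ((s : ℝ) - b)) 4])
    · exact (pow_le_pow_right₀ h hj).trans (by linarith)
  simp only [Pi.add_apply]
  nlinarith [sq_nonneg ((s : ℝ) + b), sq_nonneg ((s : ℝ) ^ 2 - b ^ 2), sq_nonneg ((s : ℝ) - b),
    mul_nonneg (sq_nonneg ((s : ℝ) + b)) (sq_nonneg ((s : ℝ) - b)),
    mul_nonneg (sq_nonneg ((s : ℝ) + b)) (sq_nonneg ((s : ℝ) + b))]

theorem integral_quartic_sub {μ : Measure ℝ≥0} [IsProbabilityMeasure μ]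
    (h : Integrable (fun s : ℝ≥0 => (s : ℝ) ^ 4) μ) (b c₀ c₁ c₂ c₃ c₄ : ℝ) :
    ∫ s : ℝ≥0, (c₀ + c₁ * ((s : ℝ) - b) + c₂ * ((s : ℝ) - b) ^ 2 + c₃ * ((s : ℝ) - b) ^ 3
      + c₄ * ((s : ℝ) - b) ^ 4) ∂μ
      = c₀ + c₁ * (∫ s : ℝ≥0, ((s : ℝ) - b) ∂μ) + c₂ * (∫ s : ℝ≥0, ((s : ℝ) - b) ^ 2 ∂μ)
        + c₃ * (∫ s : ℝ≥0, ((s : ℝ) - b) ^ 3 ∂μ) + c₄ * ∫ s : ℝ≥0, ((s : ℝ) - b) ^ 4 ∂μ := by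
  have i1 : Integrable (fun s : ℝ≥0 => c₁ * ((s : ℝ) - b)) μ := by
    simpa using (integrable_sub_pow h b (j := 1) (by norm_num)).const_mul c₁
  have i2 := (integrable_sub_pow h b (j := 2) (by norm_num)).const_mul c₂
  have i3 := (integrable_sub_pow h b (j := 3) (by norm_num)).const_mul c₃
  have i4 := (integrable_sub_pow h b (j := 4) (by norm_num)).const_mul c₄
  have j1 : Integrable (fun s : ℝ≥0 => c₀ + c₁ * ((s : ℝ) - b)) μ := (integrable_const c₀).add i1
  have j2 : Integrable (fun s : ℝ≥0 => c₀ + c₁ * ((s : ℝ) - b) + c₂ * ((s : ℝ) - b) ^ 2) μ :=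
    j1.add i2
  have j3 : Integrable (fun s : ℝ≥0 => c₀ + c₁ * ((s : ℝ) - b) + c₂ * ((s : ℝ) - b) ^ 2
    + c₃ * ((s : ℝ) - b) ^ 3) μ := j2.add i3
  rw [integral_add j3 i4, integral_add j2 i3, integral_add j1 i2,
    integral_add (integrable_const c₀) i1]
  simp only [integral_const_mul, integral_const]
  simp

/-- `μ` is a probability measure with finite fourth moment and mean `a`, whose central moments of
orders `2`, `3`, `4` are `v`, `m`, `k`. -/
structure HasCentralMoments (μ : Measure ℝ≥0) (a v m k : ℝ) : Prop where
  isProbabilityMeasure : IsProbabilityMeasure μ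
  integrable_pow_four : Integrable (fun s : ℝ≥0 => (s : ℝ) ^ 4) μ
  integral_sub : ∫ s : ℝ≥0, ((s : ℝ) - a) ∂μ = 0
  integral_sub_sq : ∫ s : ℝ≥0, ((s : ℝ) - a) ^ 2 ∂μ = v
  integral_sub_cube : ∫ s : ℝ≥0, ((s : ℝ) - a) ^ 3 ∂μ = m
  integral_sub_pow_four : ∫ s : ℝ≥0, ((s : ℝ) - a) ^ 4 ∂μ = k

namespace HasCentralMoments

variable {μ ν : Measure ℝ≥0} {a v m k a' v' m' k' : ℝ}

theorem integrable_sub_pow (h : HasCentralMoments μ a v m k) (b : ℝ) {j : ℕ} (hj : j ≤ 4) :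
    Integrable (fun s : ℝ≥0 => ((s : ℝ) - b) ^ j) μ := by
  have := h.isProbabilityMeasure
  exact _root_.integrable_sub_pow h.integrable_pow_four b hj

theorem integral_quartic (h : HasCentralMoments μ a v m k) (c₀ c₁ c₂ c₃ c₄ : ℝ) :
    ∫ s : ℝ≥0, (c₀ + c₁ * ((s : ℝ) - a) + c₂ * ((s : ℝ) - a) ^ 2 + c₃ * ((s : ℝ) - a) ^ 3
      + c₄ * ((s : ℝ) - a) ^ 4) ∂μ = c₀ + c₂ * v + c₃ * m + c₄ * k := by
  have := h.isProbabilityMeasure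
  rw [integral_quartic_sub h.integrable_pow_four, h.integral_sub, h.integral_sub_sq,
    h.integral_sub_cube, h.integral_sub_pow_four]
  ring

theorem dirac_zero : HasCentralMoments (Measure.dirac 0) 0 0 0 0 where
  isProbabilityMeasure := inferInstance
  integrable_pow_four := integrable_dirac (by simp)
  integral_sub := by simp
  integral_sub_sq := by simp
  integral_sub_cube := by simp
  integral_sub_pow_four := by simp

/-- Expand `((x - a) + (y - a')) ^ j` and integrate first in `y`: terms with a first central moment
vanish, so the only surviving cross term is `6 v v'` in degree four. -/
theorem conv (hμ : HasCentralMoments μ a v m k) (hν : HasCentralMoments ν a' v' m' k') :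
    HasCentralMoments (μ ∗ ν) (a + a') (v + v') (m + m') (k + k' + 6 * v * v') := by
  have := hμ.isProbabilityMeasure
  have := hν.isProbabilityMeasure
  have hi : Integrable (fun s : ℝ≥0 => (s : ℝ) ^ 4) (μ ∗ ν) := by
    have hm : Measurable fun p : ℝ≥0 × ℝ≥0 => p.1 + p.2 := by fun_prop
    rw [Measure.conv, integrable_map_measure (by fun_prop) hm.aemeasurable]
    have h1 := hμ.integrable_pow_four.comp_fst ν
    have h2 := hν.integrable_pow_four.comp_snd μ
    refine ((h1.const_mul 8).add (h2.const_mul 8)).mono' (by fun_prop)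
      (Eventually.of_forall fun p => ?_)
    simp only [Function.comp_apply, NNReal.coe_add, Pi.add_apply]
    rw [Real.norm_of_nonneg (by positivity)]
    nlinarith [sq_nonneg ((p.1 : ℝ) + p.2), sq_nonneg ((p.1 : ℝ) ^ 2 - p.2 ^ 2),
      mul_nonneg (sq_nonneg ((p.1 : ℝ) + p.2)) (sq_nonneg ((p.1 : ℝ) - p.2)),
      sq_nonneg (((p.1 : ℝ) - p.2) ^ 2)]
  have hj : ∀ j ≤ 4, ∫ s : ℝ≥0, ((s : ℝ) - (a + a')) ^ j ∂(μ ∗ ν)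
      = ∫ x : ℝ≥0, ∫ y : ℝ≥0, (((x : ℝ) - a) + ((y : ℝ) - a')) ^ j ∂ν ∂μ := by
    intro j hj
    rw [integral_conv (_root_.integrable_sub_pow hi _ hj)]
    refine integral_congr_ae (Eventually.of_forall fun x =>
      integral_congr_ae (Eventually.of_forall fun y => ?_))
    simp only [NNReal.coe_add]
    ring
  refine ⟨inferInstance, hi, ?_, ?_, ?_, ?_⟩
  · have h1 := hj 1 (by norm_num)
    simp only [pow_one] at h1
    rw [h1]
    trans ∫ x : ℝ≥0, (0 + 1 * ((x : ℝ) - a) + 0 * ((x : ℝ) - a) ^ 2 + 0 * ((x : ℝ) - a) ^ 3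
      + 0 * ((x : ℝ) - a) ^ 4) ∂μ
    · refine integral_congr_ae (Eventually.of_forall fun x => ?_)
      have := hν.integral_quartic ((x : ℝ) - a) 1 0 0 0
      simp only [one_mul, zero_mul, add_zero, zero_add] at this ⊢
      exact this
    · rw [hμ.integral_quartic]; ring
  · rw [hj 2 (by norm_num)]
    trans ∫ x : ℝ≥0, (v' + 0 * ((x : ℝ) - a) + 1 * ((x : ℝ) - a) ^ 2 + 0 * ((x : ℝ) - a) ^ 3
      + 0 * ((x : ℝ) - a) ^ 4) ∂μ
    · refine integral_congr_ae (Eventually.of_forall fun x => ?_)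
      have := hν.integral_quartic (((x : ℝ) - a) ^ 2) (2 * ((x : ℝ) - a)) 1 0 0
      simp only [one_mul, zero_mul, add_zero] at this ⊢
      rw [add_comm v', ← this]
      congr 1; ext y; ring
    · rw [hμ.integral_quartic]; ring
  · rw [hj 3 (by norm_num)]
    trans ∫ x : ℝ≥0, (m' + 3 * v' * ((x : ℝ) - a) + 0 * ((x : ℝ) - a) ^ 2 + 1 * ((x : ℝ) - a) ^ 3
      + 0 * ((x : ℝ) - a) ^ 4) ∂μ
    · refine integral_congr_ae (Eventually.of_forall fun x => ?_)
      have := hν.integral_quartic (((x : ℝ) - a) ^ 3) (3 * ((x : ℝ) - a) ^ 2)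
        (3 * ((x : ℝ) - a)) 1 0
      dsimp only
      trans ((x : ℝ) - a) ^ 3 + 3 * ((x : ℝ) - a) * v' + 1 * m' + 0 * k'
      · rw [← this]
        congr 1; ext y; ring
      · ring
    · rw [hμ.integral_quartic]; ring
  · rw [hj 4 (by norm_num)]
    trans ∫ x : ℝ≥0, (k' + 4 * m' * ((x : ℝ) - a) + 6 * v' * ((x : ℝ) - a) ^ 2
      + 0 * ((x : ℝ) - a) ^ 3 + 1 * ((x : ℝ) - a) ^ 4) ∂μ
    · refine integral_congr_ae (Eventually.of_forall fun x => ?_)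
      have := hν.integral_quartic (((x : ℝ) - a) ^ 4) (4 * ((x : ℝ) - a) ^ 3)
        (6 * ((x : ℝ) - a) ^ 2) (4 * ((x : ℝ) - a)) 1
      dsimp only
      trans ((x : ℝ) - a) ^ 4 + 6 * ((x : ℝ) - a) ^ 2 * v' + 4 * ((x : ℝ) - a) * m' + 1 * k'
      · rw [← this]
        congr 1; ext y; ring
      · ring
    · rw [hμ.integral_quartic]; ring

end HasCentralMoments

/-- The `n`-fold convolution power of a measure on `[0, ∞)`. -/
noncomputable def convPow (ν : Measure ℝ≥0) : ℕ → Measure ℝ≥0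
  | 0 => Measure.dirac 0
  | n + 1 => ν ∗ convPow ν n

/-- The cross terms `6 * v * (i v)` for `i < n` add up to `3 n (n - 1) v²`. -/
theorem HasCentralMoments.convPow {ν : Measure ℝ≥0} {a v m k : ℝ}
    (h : HasCentralMoments ν a v m k) (n : ℕ) :
    HasCentralMoments (convPow ν n) (n * a) (n * v) (n * m)
      (n * k + 3 * n * (n - 1) * v ^ 2) := by
  induction n with
  | zero => simpa [_root_.convPow] using HasCentralMoments.dirac_zero
  | succ n ih =>
    rw [_root_.convPow]
    convert h.conv ih using 1 <;> push_cast <;> ring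

/-! ### Powers of the generator and Taylor's formula for orbits. -/

namespace LinearPMap

variable {X : Type*} [NormedAddCommGroup X] [NormedSpace ℂ X]

theorem natPow_succ_mem_graph (A : X →ₗ.[ℂ] X) (k : ℕ) {x : X}
    (hx : x ∈ (A.natPow (k + 1)).domain) :
    (A.natPow k ⟨x, A.natPow_domain_succ_le k hx⟩, A.natPow (k + 1) ⟨x, hx⟩) ∈ A.graph := by
  have hmem : A.natPow k ⟨x, A.natPow_domain_succ_le k hx⟩ ∈ A.domain := by
    obtain ⟨⟨u, hu, rfl⟩, -⟩ := hx
    exact hu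
  exact A.mem_graph ⟨_, hmem⟩

end LinearPMap

namespace C0Semigroup

variable {X : Type*} [NormedAddCommGroup X] [NormedSpace ℂ X]

theorem norm_le_supNorm {T : C0Semigroup X} (hT : T.IsBounded) (s : ℝ≥0) : ‖T s‖ ≤ T.supNorm :=
  le_ciSup hT s

theorem supNorm_nonneg {T : C0Semigroup X} (hT : T.IsBounded) : 0 ≤ T.supNorm :=
  (norm_nonneg _).trans (norm_le_supNorm hT 0)

theorem norm_apply_le {T : C0Semigroup X} (hT : T.IsBounded) (s : ℝ≥0) (x : X) :
    ‖T s x‖ ≤ T.supNorm * ‖x‖ :=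
  (T s).le_of_opNorm_le (norm_le_supNorm hT s) x

theorem IsBounded.rescale {T : C0Semigroup X} (hT : T.IsBounded) (c : ℝ≥0) :
    (T.rescale c).IsBounded :=
  ⟨T.supNorm, by rintro _ ⟨s, rfl⟩; exact norm_le_supNorm hT _⟩

theorem integrable_orbit {T : C0Semigroup X} (hT : T.IsBounded) (μ : Measure ℝ≥0)
    [IsFiniteMeasure μ] (x : X) : Integrable (fun s => T s x) μ :=
  Integrable.of_bound (T.strongly_continuous x).aestronglyMeasurable (T.supNorm * ‖x‖)
    (Eventually.of_forall fun s => norm_apply_le hT s x)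

theorem continuous_orbit (T : C0Semigroup X) (x : X) :
    Continuous fun u : ℝ => T u.toNNReal x :=
  (T.strongly_continuous x).comp continuous_real_toNNReal

variable {T : C0Semigroup X} {A : X →ₗ.[ℂ] X}

/-- The generator is a one-sided limit, so factoring out `T a` gives the right derivative directly;
with continuity of the orbit this suffices for the fundamental theorem of calculus. -/
theorem HasNegGenerator.hasDerivWithinAt_orbit (hA : T.HasNegGenerator A) {x y : X}
    (h : (x, y) ∈ A.graph) {a : ℝ} (ha : 0 ≤ a) :
    HasDerivWithinAt (fun u : ℝ => T u.toNNReal x) (-T a.toNNReal y) (Ioi a) a := by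
  rw [hasDerivWithinAt_iff_tendsto_slope' self_notMem_Ioi]
  have h1 : Tendsto (fun u : ℝ => (u - a).toNNReal) (𝓝[>] a) (𝓝[>] 0) := by
    refine tendsto_nhdsWithin_iff.2 ⟨?_, ?_⟩
    · have : Continuous fun u : ℝ => (u - a).toNNReal := by fun_prop
      simpa using (this.tendsto a).mono_left nhdsWithin_le_nhds
    · filter_upwards [self_mem_nhdsWithin] with u hu
      exact Real.toNNReal_pos.2 (sub_pos.2 hu)
  have h2 := (((T a.toNNReal).continuous.tendsto y).comp (((hA x y).1 h).comp h1)).neg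
  refine h2.congr' ?_
  filter_upwards [self_mem_nhdsWithin] with u hu
  have hu' : 0 ≤ u - a := (sub_pos.2 hu).le
  have e : u.toNNReal = a.toNNReal + (u - a).toNNReal := by
    rw [← Real.toNNReal_add ha hu', add_sub_cancel]
  simp only [Function.comp_apply, slope_def_module, Real.coe_toNNReal _ hu']
  rw [e, T.map_add, ContinuousLinearMap.map_smul_of_tower, ← smul_neg, map_sub, neg_sub]
  rfl

variable [CompleteSpace X]

theorem HasNegGenerator.integral_orbit (hA : T.HasNegGenerator A) {x y : X}
    (h : (x, y) ∈ A.graph) {a b : ℝ} (ha : 0 ≤ a) (hb : 0 ≤ b) :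
    ∫ u in a..b, T u.toNNReal y = T a.toNNReal x - T b.toNNReal x := by
  have := intervalIntegral.integral_eq_sub_of_hasDeriv_right
    (f := fun u : ℝ => T u.toNNReal x) (f' := fun u : ℝ => -T u.toNNReal y) (a := a) (b := b)
    (T.continuous_orbit x).continuousOn
    (fun u hu => hA.hasDerivWithinAt_orbit h ((le_min ha hb).trans hu.1.le))
    (Continuous.intervalIntegrable (by have := T.continuous_orbit y; fun_prop) _ _)
  rw [intervalIntegral.integral_neg] at this
  rw [← neg_sub, ← this, neg_neg]

/-- Taylor's formula for the orbit `u ↦ T u (y 0)`, where `y (j + 1) = A (y j)`. -/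
theorem HasNegGenerator.norm_orbit_sub_taylor_le (hA : T.HasNegGenerator A) (hT : T.IsBounded)
    (N : ℕ) {y : ℕ → X} (hy : ∀ j < N, (y j, y (j + 1)) ∈ A.graph) {a b : ℝ} (ha : 0 ≤ a)
    (hb : 0 ≤ b) :
    ‖T b.toNNReal (y 0)
        - ∑ j ∈ Finset.range N, ((a - b) ^ j / (j.factorial : ℝ)) • T a.toNNReal (y j)‖
      ≤ T.supNorm * ‖y N‖ * (|b - a| ^ N / N.factorial) := by
  induction N generalizing y b with
  | zero => simpa using norm_apply_le hT _ _
  | succ N ih =>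
    -- `R u` is the order-`N` remainder for the orbit of `y 1 = A (y 0)`. Its integral from `a` to
    -- `b` is minus the remainder of order `N + 1` for `y 0`.
    set R : ℝ → X := fun u => T u.toNNReal (y 1)
      - ∑ j ∈ Finset.range N, ((a - u) ^ j / (j.factorial : ℝ)) • T a.toNNReal (y (j + 1)) with hR
    have hRb : ∀ u : ℝ, 0 ≤ u → ‖R u‖ ≤ T.supNorm * ‖y (N + 1)‖ * (|u - a| ^ N / N.factorial) :=
      fun u hu => ih (y := fun j => y (j + 1)) (fun j hj => hy (j + 1) (by omega)) hu
    have hpow : ∀ j : ℕ, ∫ u in a..b, (a - u) ^ j / (j.factorial : ℝ)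
        = -((a - b) ^ (j + 1) / ((j + 1).factorial : ℝ)) := by
      intro j
      rw [intervalIntegral.integral_div, intervalIntegral.integral_comp_sub_left (fun u => u ^ j),
        integral_pow, sub_self, Nat.factorial_succ]
      push_cast
      have : (j.factorial : ℝ) ≠ 0 := by positivity
      have : (j : ℝ) + 1 ≠ 0 := by positivity
      field_simp
      ring
    have key : T b.toNNReal (y 0)
        - ∑ j ∈ Finset.range (N + 1), ((a - b) ^ j / (j.factorial : ℝ)) • T a.toNNReal (y j)
        = -∫ u in a..b, R u := by
      have hi : ∀ j ∈ Finset.range N, IntervalIntegrable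
          (fun u : ℝ => ((a - u) ^ j / (j.factorial : ℝ)) • T a.toNNReal (y (j + 1))) volume a b :=
        fun j _ => Continuous.intervalIntegrable (by fun_prop) _ _
      rw [hR, intervalIntegral.integral_sub ((T.continuous_orbit _).intervalIntegrable _ _)
        (Continuous.intervalIntegrable (by fun_prop) _ _),
        intervalIntegral.integral_finsetSum hi,
        hA.integral_orbit (hy 0 (Nat.succ_pos N)) ha hb, Finset.sum_range_succ']
      simp only [intervalIntegral.integral_smul_const, hpow, neg_smul, Finset.sum_neg_distrib]
      simp
      abel
    rw [key, norm_neg]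
    set C := T.supNorm * ‖y (N + 1)‖ / N.factorial with hC
    have hle : ∀ u ∈ uIoc a b, ‖R u‖ ≤ C * |u - a| ^ N := fun u hu => by
      refine (hRb u ((le_min ha hb).trans hu.1.le)).trans_eq ?_
      rw [hC]; ring
    calc ‖∫ u in a..b, R u‖ ≤ ∫ u in uIoc a b, ‖R u‖ :=
          intervalIntegral.norm_integral_le_integral_norm_uIoc
      _ ≤ ∫ u in uIoc a b, C * |u - a| ^ N := by
        refine setIntegral_mono_on ?_ ?_ measurableSet_uIoc hle
        · have : Continuous R :=
            (T.continuous_orbit _).sub (continuous_finsetSum _ fun j _ => by fun_prop)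
          exact (this.norm.integrableOn_uIcc).mono_set uIoc_subset_uIcc
        · exact (Continuous.integrableOn_uIcc (by fun_prop)).mono_set uIoc_subset_uIcc
      _ = C * (|b - a| ^ (N + 1) / (N + 1)) := by
        rw [integral_const_mul, integral_pow_abs_sub_uIoc]
      _ = _ := by
        rw [hC, Nat.factorial_succ]; push_cast
        have : (N.factorial : ℝ) ≠ 0 := by positivity
        field_simp

end C0Semigroup

/-! ### Powers of the operator as convolution powers of the measure. -/

instance isFiniteMeasure_convPow (ν : Measure ℝ≥0) [IsFiniteMeasure ν] (n : ℕ) :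
    IsFiniteMeasure (convPow ν n) := by
  induction n with
  | zero => rw [convPow]; infer_instance
  | succ n ih => rw [convPow]; infer_instance

/-- Bounded operators pass through the Bochner integral, and `T s (T r x) = T (s + r) x`, so
composition becomes convolution. -/
theorem C0Semigroup.iterate_integral_orbit {X : Type*} [NormedAddCommGroup X] [NormedSpace ℂ X]
    [CompleteSpace X] {T : C0Semigroup X} (hT : T.IsBounded) (ν : Measure ℝ≥0) [IsFiniteMeasure ν]
    (n : ℕ) (x : X) : (fun x => ∫ s, T s x ∂ν)^[n] x = ∫ s, T s x ∂convPow ν n := by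
  induction n with
  | zero => simp [convPow, T.map_zero]
  | succ n ih =>
    rw [Function.iterate_succ_apply', ih, convPow,
      integral_conv (C0Semigroup.integrable_orbit hT _ x)]
    refine integral_congr_ae (Eventually.of_forall fun s => ?_)
    dsimp only
    rw [← ContinuousLinearMap.integral_comp_comm _ (C0Semigroup.integrable_orbit hT _ x)]
    simp only [T.map_add, ContinuousLinearMap.comp_apply]

/-! ### Inequalities between central moments. -/

namespace HasCentralMoments

variable {μ : Measure ℝ≥0} {a v m k : ℝ}

theorem variance_nonneg (h : HasCentralMoments μ a v m k) : 0 ≤ v := by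
  rw [← h.integral_sub_sq]
  exact integral_nonneg fun s => sq_nonneg _

theorem fourth_nonneg (h : HasCentralMoments μ a v m k) : 0 ≤ k := by
  rw [← h.integral_sub_pow_four]
  exact integral_nonneg fun s => by positivity

theorem variance_sq_le (h : HasCentralMoments μ a v m k) : v ^ 2 ≤ k := by
  have h1 := h.integral_quartic (v ^ 2) 0 (-(2 * v)) 0 1
  have h2 : 0 ≤ ∫ s : ℝ≥0, (v ^ 2 + 0 * ((s : ℝ) - a) + -(2 * v) * ((s : ℝ) - a) ^ 2
      + 0 * ((s : ℝ) - a) ^ 3 + 1 * ((s : ℝ) - a) ^ 4) ∂μ :=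
    integral_nonneg fun s => by
      simp only [Pi.zero_apply]
      nlinarith [sq_nonneg (((s : ℝ) - a) ^ 2 - v)]
  linarith

/-- Integrate `s (s - 1 - v)² ≥ 0`; among the shifts `c` in `s (s - 1 - c)²`, `c = v` gives the
sharpest bound. -/
theorem variance_sq_sub_le_third (h : HasCentralMoments μ 1 v m k) : v ^ 2 - v ≤ m := by
  have h1 := h.integral_quartic (v ^ 2) (v ^ 2 - 2 * v) (1 - 2 * v) 1 0
  have h2 : 0 ≤ ∫ s : ℝ≥0, (v ^ 2 + (v ^ 2 - 2 * v) * ((s : ℝ) - 1) + (1 - 2 * v) * ((s : ℝ) - 1) ^ 2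
      + 1 * ((s : ℝ) - 1) ^ 3 + 0 * ((s : ℝ) - 1) ^ 4) ∂μ :=
    integral_nonneg fun s => by
      simp only [Pi.zero_apply]
      have := mul_nonneg s.coe_nonneg (sq_nonneg ((s : ℝ) - 1 - v))
      linarith
  linarith

theorem integrable_abs_sub_pow (h : HasCentralMoments μ a v m k) {j : ℕ} (hj : j ≤ 4) :
    Integrable (fun s : ℝ≥0 => |(s : ℝ) - a| ^ j) μ := by
  simpa only [abs_pow] using (h.integrable_sub_pow a hj).abs

/-- Cauchy–Schwarz for `|s - a|` and `(s - a)²`, by way of the discriminant of `l ↦ E (l|s - a| - (s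
- a)²)²`. -/
theorem integral_abs_cube_sq_le (h : HasCentralMoments μ a v m k) :
    (∫ s : ℝ≥0, |(s : ℝ) - a| ^ 3 ∂μ) ^ 2 ≤ v * k := by
  have hq : ∀ l : ℝ, 0 ≤ v * (l * l) + (-2 * ∫ s : ℝ≥0, |(s : ℝ) - a| ^ 3 ∂μ) * l + k := by
    intro l
    have i2 := (h.integrable_sub_pow a (j := 2) (by norm_num)).mul_const (l * l)
    have i3 := (h.integrable_abs_sub_pow (j := 3) (by norm_num)).mul_const (-2 * l)
    have i4 := h.integrable_sub_pow a (j := 4) le_rfl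
    have i23 : Integrable (fun s : ℝ≥0 => ((s : ℝ) - a) ^ 2 * (l * l)
      + |(s : ℝ) - a| ^ 3 * (-2 * l)) μ := i2.add i3
    have e : ∫ s : ℝ≥0, (((s : ℝ) - a) ^ 2 * (l * l) + |(s : ℝ) - a| ^ 3 * (-2 * l)
        + ((s : ℝ) - a) ^ 4) ∂μ
        = v * (l * l) + (-2 * ∫ s : ℝ≥0, |(s : ℝ) - a| ^ 3 ∂μ) * l + k := by
      rw [integral_add i23 i4, integral_add i2 i3, integral_mul_const, integral_mul_const,
        h.integral_sub_sq, h.integral_sub_pow_four]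
      ring
    rw [← e]
    refine integral_nonneg fun s => ?_
    have e1 : ((s : ℝ) - a) ^ 2 = |(s : ℝ) - a| ^ 2 := (sq_abs _).symm
    have e2 : ((s : ℝ) - a) ^ 4 = |(s : ℝ) - a| ^ 4 := (Even.pow_abs (by decide) _).symm
    simp only [Pi.zero_apply, e1, e2]
    have := sq_nonneg (|(s : ℝ) - a| * l - |(s : ℝ) - a| ^ 2)
    linarith
  have := discrim_le_zero hq
  rw [discrim] at this
  linarith

theorem third_sq_le (h : HasCentralMoments μ a v m k) : m ^ 2 ≤ v * k := by
  refine le_trans ?_ h.integral_abs_cube_sq_le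
  rw [← h.integral_sub_cube]
  refine sq_le_sq.2 ((abs_integral_le_integral_abs).trans ?_)
  simp only [abs_pow]
  exact le_abs_self _

end HasCentralMoments

theorem IsRepresentingMeasure.hasCentralMoments {g : ℝ → ℝ} {ν : Measure ℝ≥0} {g₂ g₃ g₄ : ℝ}
    (hν : IsRepresentingMeasure g ν) (hg : IsCompletelyMonotone g) (h0 : DerivZeroEq g 0 1)
    (h1 : DerivZeroEq g 1 (-1)) (h2 : DerivZeroEq g 2 g₂) (h3 : DerivZeroEq g 3 g₃)
    (h4 : DerivZeroEq g 4 g₄) :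
    HasCentralMoments ν 1 (g₂ - 1) (-g₃ - 3 * g₂ + 2) (g₄ + 4 * g₃ + 6 * g₂ - 3) := by
  have hfin := hν.1
  have hm0 := hν.integral_pow_eq hg h0
  have hm1 := hν.integral_pow_eq hg h1
  have hm2 := hν.integral_pow_eq hg h2
  have hm3 := hν.integral_pow_eq hg h3
  have hm4 := hν.integral_pow_eq hg h4
  have hprob : IsProbabilityMeasure ν := by
    constructor
    simp only [pow_zero, integral_const, smul_eq_mul, mul_one] at hm0
    rwa [Measure.real, ENNReal.toReal_eq_one_iff] at hm0
  have hi := hν.integrable_pow h4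
  have key := fun c₀ c₁ c₂ c₃ c₄ => integral_quartic_sub hi 0 c₀ c₁ c₂ c₃ c₄
  simp only [sub_zero, hm2, hm3, hm4] at key
  simp only [pow_one] at hm1
  simp only [hm1] at key
  refine ⟨hprob, hi, ?_, ?_, ?_, ?_⟩
  · trans -1 + 1 * (-1 * -1) + 0 * ((-1) ^ 2 * g₂) + 0 * ((-1) ^ 3 * g₃) + 0 * ((-1) ^ 4 * g₄)
    · rw [← key]; congr 1; ext s; ring
    · ring
  · trans 1 + (-2) * (-1 * -1) + 1 * ((-1) ^ 2 * g₂) + 0 * ((-1) ^ 3 * g₃) + 0 * ((-1) ^ 4 * g₄)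
    · rw [← key]; congr 1; ext s; ring
    · ring
  · trans -1 + 3 * (-1 * -1) + (-3) * ((-1) ^ 2 * g₂) + 1 * ((-1) ^ 3 * g₃) + 0 * ((-1) ^ 4 * g₄)
    · rw [← key]; congr 1; ext s; ring
    · ring
  · trans 1 + (-4) * (-1 * -1) + 6 * ((-1) ^ 2 * g₂) + (-4) * ((-1) ^ 3 * g₃) + 1 * ((-1) ^ 4 * g₄)
    · rw [← key]; congr 1; ext s; ring
    · ring

/-- Bernstein's theorem rules out the dummy branch of the definition. -/
theorem isRepresentingMeasure_representingMeasure {g : ℝ → ℝ} (hg : IsCompletelyMonotone g)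
    (h0 : DerivZeroEq g 0 1) : IsRepresentingMeasure g (representingMeasure g) := by
  have h : ∃ ν : Measure ℝ≥0, IsRepresentingMeasure g ν :=
    hg.exists_isRepresentingMeasure (by simpa only [DerivZeroEq, iteratedDeriv_zero] using h0)
  rw [representingMeasure, dif_pos h]
  exact h.choose_spec

/-! ### Averaged Taylor expansion and the two error bounds. -/

namespace C0Semigroup

variable {X : Type*} [NormedAddCommGroup X] [NormedSpace ℂ X] [CompleteSpace X]
  {T : C0Semigroup X} {A : X →ₗ.[ℂ] X}

/-- Averaging Taylor's formula for an orbit, expanded at time `c * r`, over the times `c * s`. -/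
theorem HasNegGenerator.norm_integral_orbit_sub_taylor_le (hA : T.HasNegGenerator A)
    (hT : T.IsBounded) {μ : Measure ℝ≥0} [IsFiniteMeasure μ]
    (hμ : Integrable (fun s : ℝ≥0 => (s : ℝ) ^ 4) μ) (c r : ℝ≥0) {N : ℕ} (hN : N ≤ 4) {y : ℕ → X}
    (hy : ∀ j < N, (y j, y (j + 1)) ∈ A.graph) :
    ‖∫ s, T (c * s) (y 0) ∂μ - ∑ j ∈ Finset.range N,
        ((-c : ℝ) ^ j * (∫ s : ℝ≥0, ((s : ℝ) - r) ^ j ∂μ) / (j.factorial : ℝ)) • T (c * r) (y j)‖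
      ≤ T.supNorm * ‖y N‖ * ((c : ℝ) ^ N / N.factorial * ∫ s : ℝ≥0, |(s : ℝ) - r| ^ N ∂μ) := by
  have hi : ∀ j ∈ Finset.range N, Integrable (fun s : ℝ≥0 =>
      ((-c : ℝ) ^ j * ((s : ℝ) - r) ^ j / (j.factorial : ℝ)) • T (c * r) (y j)) μ := fun j hj =>
    (((integrable_sub_pow hμ r ((Finset.mem_range.1 hj).le.trans hN)).const_mul _).div_const
      _).smul_const _
  have e : ∫ s, T (c * s) (y 0) ∂μ - ∑ j ∈ Finset.range N,
        ((-c : ℝ) ^ j * (∫ s : ℝ≥0, ((s : ℝ) - r) ^ j ∂μ) / (j.factorial : ℝ)) • T (c * r) (y j)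
      = ∫ s : ℝ≥0, (T (c * s) (y 0) - ∑ j ∈ Finset.range N,
        ((-c : ℝ) ^ j * ((s : ℝ) - r) ^ j / (j.factorial : ℝ)) • T (c * r) (y j)) ∂μ := by
    have h0 : Integrable (fun s => T (c * s) (y 0)) μ := integrable_orbit (hT.rescale c) μ (y 0)
    rw [integral_sub h0 (integrable_finsetSum _ hi),
      integral_finsetSum _ hi]
    simp only [integral_smul_const, integral_div, integral_const_mul]
  rw [e, ← integral_const_mul, ← integral_const_mul]
  refine norm_integral_le_of_norm_le ?_ (Eventually.of_forall fun s => ?_)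
  · have := (integrable_sub_pow hμ r hN).abs
    simp only [abs_pow] at this
    exact (this.const_mul _).const_mul _
  · have := hA.norm_orbit_sub_taylor_le hT N hy (mul_nonneg c.2 r.2) (mul_nonneg c.2 s.2)
    have e1 : Real.toNNReal (c.1 * s.1) = c * s := Real.toNNReal_coe (r := c * s)
    have e2 : Real.toNNReal (c.1 * r.1) = c * r := Real.toNNReal_coe (r := c * r)
    rw [e1, e2] at this
    change ‖_‖ ≤ T.supNorm * ‖y N‖ * ((c : ℝ) ^ N / N.factorial * |(s : ℝ) - r| ^ N)
    refine (le_of_eq ?_).trans (this.trans_eq ?_)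
    · congr 2
      refine Finset.sum_congr rfl fun j _ => ?_
      rw [← mul_pow]
      congr 3
      change -(c : ℝ) * (s - r) = c * r - c * s
      ring
    · change T.supNorm * ‖y N‖ * (|(c : ℝ) * s - c * r| ^ N / N.factorial) = _
      rw [← mul_sub, abs_mul, abs_of_nonneg c.coe_nonneg, mul_pow]
      ring

end C0Semigroup

theorem exists_hasCentralMoments_convPow_representingMeasure {g : ℝ → ℝ} {g₂ g₃ g₄ : ℝ}
    (hg : IsCompletelyMonotone g) (h0 : DerivZeroEq g 0 1)
    (h1 : DerivZeroEq g 1 (-1)) (h2 : DerivZeroEq g 2 g₂) (h3 : DerivZeroEq g 3 g₃)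
    (h4 : DerivZeroEq g 4 g₄) :
    ∃ m k : ℝ, 0 ≤ g₂ - 1 ∧ (g₂ - 1) ^ 2 ≤ k ∧ k ≤ g₄ - 1 ∧ |m| ≤ g₄ - 1 ∧
      ∀ n : ℕ, HasCentralMoments (convPow (representingMeasure g) n) n (n * (g₂ - 1)) (n * m)
        (n * k + 3 * n * (n - 1) * (g₂ - 1) ^ 2) := by
  have h := (isRepresentingMeasure_representingMeasure hg h0).hasCentralMoments hg h0 h1 h2 h3 h4
  have hv := h.variance_nonneg
  have hk := h.fourth_nonneg
  have hvk := h.variance_sq_le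
  have hm := h.variance_sq_sub_le_third
  have hm2 := h.third_sq_le
  -- Here `g₄ - 1 = k + 4m + 6v`, and `m ≥ v² - v` gives `4m + 6v ≥ 4v² + 2v ≥ 0`.
  refine ⟨_, _, hv, hvk, by nlinarith, ?_, fun n => by simpa using h.convPow n⟩
  have hv' : g₂ - 1 ≤ g₄ - 1 := by nlinarith
  -- `m² ≤ v k`, and both factors are at most `g₄ - 1`.
  refine abs_le_of_sq_le_sq (hm2.trans ?_) (hv.trans hv')
  rw [sq]
  exact mul_le_mul hv' (by nlinarith) hk (hv.trans hv')

/-- Since `v² ≤ k`, the fourth central moment is at most `3 n² k`, whence `J² ≤ 3 n³ v w`. Division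
by `36 n⁶` would even give `v w / 12` under the root. -/
theorem div_pow_three_le_sqrt_mul_rpow {n : ℕ} (hn : 1 ≤ n) {J v k w : ℝ} (hv : 0 ≤ v)
    (hvk : v ^ 2 ≤ k) (hkw : k ≤ w)
    (hJ : J ^ 2 ≤ n * v * (n * k + 3 * n * (n - 1) * v ^ 2)) :
    J / (6 * (n : ℝ) ^ 3) ≤ √(v * w / 2) * (n : ℝ) ^ (-(3 / 2) : ℝ) := by
  have hn1 : (1 : ℝ) ≤ n := by exact_mod_cast hn
  have hn0 : (0 : ℝ) < n := by linarith
  have hk : 0 ≤ k := (sq_nonneg v).trans hvk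
  have hr : ((n : ℝ) ^ (-(3 / 2) : ℝ)) ^ 2 = ((n : ℝ) ^ 3)⁻¹ := by
    rw [← Real.rpow_natCast, ← Real.rpow_mul hn0.le, ← Real.rpow_natCast (n : ℝ) 3,
      ← Real.rpow_neg hn0.le]
    norm_num
  refine le_of_sq_le_sq ?_ (by positivity)
  rw [mul_pow, hr, Real.sq_sqrt (by have := hk.trans hkw; positivity), div_pow]
  have h1 : (n : ℝ) * k + 3 * n * (n - 1) * v ^ 2 ≤ 3 * n ^ 2 * k := by
    have a1 : 3 * (n : ℝ) * (n - 1) * v ^ 2 ≤ 3 * n * (n - 1) * k := by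
      have : 0 ≤ (n : ℝ) - 1 := by linarith
      gcongr
    have a2 : 0 ≤ (n : ℝ) * k := by positivity
    nlinarith
  have h2 : J ^ 2 ≤ 3 * (n : ℝ) ^ 3 * (v * w) := by
    refine hJ.trans ((mul_le_mul_of_nonneg_left h1 (by positivity)).trans ?_)
    have : 3 * (n : ℝ) ^ 3 * (v * k) ≤ 3 * (n : ℝ) ^ 3 * (v * w) := by gcongr
    linarith
  rw [div_le_iff₀ (by positivity)]
  have h3 : v * w / 2 * ((n : ℝ) ^ 3)⁻¹ * (6 * (n : ℝ) ^ 3) ^ 2 = 18 * (n : ℝ) ^ 3 * (v * w) := by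
    field_simp
    ring
  rw [h3]
  have : 0 ≤ (n : ℝ) ^ 3 * (v * w) := by have := hk.trans hkw; positivity
  linarith

namespace C0Semigroup

variable {X : Type*} [NormedAddCommGroup X] [NormedSpace ℂ X] [CompleteSpace X]
  {T : C0Semigroup X} {A : X →ₗ.[ℂ] X}

theorem HasNegGenerator.norm_sub_expansion_le_of_chain_three (hA : T.HasNegGenerator A)
    (hT : T.IsBounded) {μ : Measure ℝ≥0} {n : ℕ} (hn : 1 ≤ n) {v m k w : ℝ}
    (hμ : HasCentralMoments μ n (n * v) (n * m) (n * k + 3 * n * (n - 1) * v ^ 2))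
    (hv : 0 ≤ v) (hvk : v ^ 2 ≤ k) (hkw : k ≤ w)
    (t : ℝ≥0) {y : ℕ → X} (hy : ∀ j < 3, (y j, y (j + 1)) ∈ A.graph) :
    ‖∫ s, T (t / n * s) (y 0) ∂μ - T t (y 0) - ((2 * n : ℝ)⁻¹ * v * (t : ℝ) ^ 2) • T t (y 2)‖
      ≤ T.supNorm * √(v * w / 2) * (t : ℝ) ^ 3 * (n : ℝ) ^ (-(3 / 2) : ℝ) * ‖y 3‖ := by
  have := hμ.isProbabilityMeasure
  have hn0 : (n : ℝ) ≠ 0 := Nat.cast_ne_zero.2 (by omega)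
  have htn : t / n * n = t := div_mul_cancel₀ t (by exact_mod_cast hn0)
  have h := hA.norm_integral_orbit_sub_taylor_le hT hμ.integrable_pow_four (t / n) n
    (by norm_num : 3 ≤ 4) hy
  have hM := supNorm_nonneg hT
  simp only [Finset.sum_range_succ, Finset.sum_range_zero, NNReal.coe_natCast, pow_one,
    hμ.integral_sub, hμ.integral_sub_sq, htn] at h
  have hJ := div_pow_three_le_sqrt_mul_rpow hn hv hvk hkw hμ.integral_abs_cube_sq_le
  set J := ∫ s : ℝ≥0, |(s : ℝ) - n| ^ 3 ∂μ
  have hc : (-((t / n : ℝ≥0) : ℝ)) ^ 2 * (n * v) / ((2).factorial : ℝ)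
      = (2 * n : ℝ)⁻¹ * v * (t : ℝ) ^ 2 := by
    simp only [NNReal.coe_div, NNReal.coe_natCast, Nat.factorial_two, Nat.cast_ofNat]
    field_simp
  rw [hc] at h
  simp only [pow_zero, integral_const, probReal_univ, smul_eq_mul, mul_one, mul_zero, zero_div,
    zero_smul, add_zero, zero_add, Nat.factorial_zero, Nat.cast_one, div_one, one_smul] at h
  rw [sub_sub]
  refine h.trans ?_
  have e : T.supNorm * ‖y 3‖ * (((t / n : ℝ≥0) : ℝ) ^ 3 / ((3).factorial : ℝ) * J)
      = T.supNorm * ‖y 3‖ * (t : ℝ) ^ 3 * (J / (6 * (n : ℝ) ^ 3)) := by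
    simp only [NNReal.coe_div, NNReal.coe_natCast, Nat.factorial]
    push_cast
    field_simp
  rw [e]
  refine (mul_le_mul_of_nonneg_left hJ (by positivity)).trans_eq ?_
  ring

theorem HasNegGenerator.norm_sub_expansion_le_of_chain_four (hA : T.HasNegGenerator A)
    (hT : T.IsBounded) {μ : Measure ℝ≥0} {n : ℕ} (hn : 1 ≤ n) {v m k w : ℝ}
    (hμ : HasCentralMoments μ n (n * v) (n * m) (n * k + 3 * n * (n - 1) * v ^ 2))
    (hvk : v ^ 2 ≤ k) (hkw : k ≤ w) (hmw : |m| ≤ w)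
    (t : ℝ≥0) {y : ℕ → X} (hy : ∀ j < 4, (y j, y (j + 1)) ∈ A.graph) :
    ‖∫ s, T (t / n * s) (y 0) ∂μ - T t (y 0) - ((2 * n : ℝ)⁻¹ * v * (t : ℝ) ^ 2) • T t (y 2)‖
      ≤ T.supNorm * w * (t : ℝ) ^ 3 * ((n : ℝ) ^ 2)⁻¹ * (‖y 3‖ + (t : ℝ) * ‖y 4‖) := by
  have := hμ.isProbabilityMeasure
  have hn1 : (1 : ℝ) ≤ n := by exact_mod_cast hn
  have hn0 : (0 : ℝ) < n := by linarith
  have htn : t / n * n = t := div_mul_cancel₀ t (by exact_mod_cast hn0.ne')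
  have h := hA.norm_integral_orbit_sub_taylor_le hT hμ.integrable_pow_four (t / n) n le_rfl hy
  have hM := supNorm_nonneg hT
  have hk : 0 ≤ k := (sq_nonneg v).trans hvk
  have hw : 0 ≤ w := hk.trans hkw
  simp only [Finset.sum_range_succ, Finset.sum_range_zero, NNReal.coe_natCast, pow_one,
    hμ.integral_sub, hμ.integral_sub_sq, hμ.integral_sub_cube, htn,
    Even.pow_abs (by decide : Even 4), hμ.integral_sub_pow_four] at h
  have hc2 : (-((t / n : ℝ≥0) : ℝ)) ^ 2 * (n * v) / ((2).factorial : ℝ)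
      = (2 * n : ℝ)⁻¹ * v * (t : ℝ) ^ 2 := by
    simp only [NNReal.coe_div, NNReal.coe_natCast, Nat.factorial_two, Nat.cast_ofNat]
    field_simp
  have hc3 : (-((t / n : ℝ≥0) : ℝ)) ^ 3 * (n * m) / ((3).factorial : ℝ)
      = -(m * (t : ℝ) ^ 3 / (6 * (n : ℝ) ^ 2)) := by
    simp only [NNReal.coe_div, NNReal.coe_natCast, Nat.factorial]
    push_cast
    field_simp
  rw [hc2, hc3] at h
  simp only [pow_zero, integral_const, probReal_univ, smul_eq_mul, mul_one, mul_zero, zero_div,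
    zero_smul, add_zero, zero_add, Nat.factorial_zero, Nat.cast_one, div_one, one_smul] at h
  set R := ∫ s, T (t / n * s) (y 0) ∂μ
    - (T t (y 0) + ((2 * n : ℝ)⁻¹ * v * (t : ℝ) ^ 2) • T t (y 2)
      + (-(m * (t : ℝ) ^ 3 / (6 * (n : ℝ) ^ 2))) • T t (y 3)) with hR
  -- The cubic Taylor term is not part of the approximation, so it joins the error and accounts for
  -- `‖y 3‖`.
  have e : ∫ s, T (t / n * s) (y 0) ∂μ - T t (y 0) - ((2 * n : ℝ)⁻¹ * v * (t : ℝ) ^ 2) • T t (y 2)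
      = (-(m * (t : ℝ) ^ 3 / (6 * (n : ℝ) ^ 2))) • T t (y 3) + R := by
    rw [hR]; abel
  have b3 : ‖(-(m * (t : ℝ) ^ 3 / (6 * (n : ℝ) ^ 2))) • T t (y 3)‖
      ≤ w * (t : ℝ) ^ 3 * ((n : ℝ) ^ 2)⁻¹ * (T.supNorm * ‖y 3‖) := by
    rw [norm_smul, norm_neg, Real.norm_eq_abs, abs_div, abs_mul,
      abs_of_nonneg (by positivity : 0 ≤ (t : ℝ) ^ 3),
      abs_of_pos (by positivity : 0 < 6 * (n : ℝ) ^ 2), ← div_eq_mul_inv]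
    gcongr
    · nlinarith [sq_nonneg (n : ℝ)]
    · exact norm_apply_le hT t _
  have b4 : ‖R‖ ≤ T.supNorm * ‖y 4‖ * (w * (t : ℝ) ^ 4 * ((n : ℝ) ^ 2)⁻¹) := by
    refine h.trans (mul_le_mul_of_nonneg_left ?_ (by positivity))
    -- The generous factor `24` is chosen to cancel the `4!` of Taylor's formula.
    have h1 : (n : ℝ) * k + 3 * n * (n - 1) * v ^ 2 ≤ 24 * n ^ 2 * w := by
      have a1 : 3 * (n : ℝ) * (n - 1) * v ^ 2 ≤ 3 * n * (n - 1) * w := by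
        have : 0 ≤ (n : ℝ) - 1 := by linarith
        have := hvk.trans hkw
        gcongr
      have a2 : (n : ℝ) * k ≤ n * w := by gcongr
      have a3 : 0 ≤ (n : ℝ) * w := by positivity
      have a4 : (n : ℝ) * w ≤ n * (n * w) := by nlinarith
      nlinarith
    calc ((t / n : ℝ≥0) : ℝ) ^ 4 / ((4).factorial : ℝ) * (n * k + 3 * n * (n - 1) * v ^ 2)
        ≤ ((t / n : ℝ≥0) : ℝ) ^ 4 / ((4).factorial : ℝ) * (24 * n ^ 2 * w) := by gcongr
      _ = _ := by
        simp only [NNReal.coe_div, NNReal.coe_natCast, Nat.factorial]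
        push_cast
        field_simp
  rw [e]
  refine (norm_add_le _ _).trans ((add_le_add b3 b4).trans_eq ?_)
  ring

end C0Semigroup

/-! ### Assembly of the theorem. -/

theorem hillePhillips_rescale_iterate {X : Type*} [NormedAddCommGroup X] [NormedSpace ℂ X]
    [CompleteSpace X] {T : C0Semigroup X} (hT : T.IsBounded) {g : ℝ → ℝ}
    (hg : IsCompletelyMonotone g) (h0 : DerivZeroEq g 0 1) (c : ℝ≥0) (n : ℕ) (x : X) :
    (hillePhillips (T.rescale c) g)^[n] x
      = ∫ s, T (c * s) x ∂convPow (representingMeasure g) n := by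
  have := (isRepresentingMeasure_representingMeasure hg h0).1
  exact C0Semigroup.iterate_integral_orbit (hT.rescale c) _ n x

/-- Second order approximation of bounded `C₀`-semigroups. Here `T t = e^{-tA}`, the numbers
`g₂ t`, `g₃ t`, `g₄ t` are `g_t''(0)`, `g_t'''(0)`, `g_t''''(0)`, and
`(hillePhillips (T.rescale (t / n)) (g t))^[n]` is the `n`-th power of the operator
`g_t(tA/n)`. -/
theorem theorem1p2 {X : Type*} [NormedAddCommGroup X] [NormedSpace ℂ X] [CompleteSpace X]
    (T : C0Semigroup X) (hT : T.IsBounded)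
    (A : X →ₗ.[ℂ] X) (hA : T.HasNegGenerator A)
    (g : ℝ≥0 → ℝ → ℝ) (g₂ g₃ g₄ : ℝ≥0 → ℝ)
    (hcm : ∀ t : ℝ≥0, 0 < t → IsCompletelyMonotone (g t))
    (h0 : ∀ t : ℝ≥0, 0 < t → DerivZeroEq (g t) 0 1)
    (h1 : ∀ t : ℝ≥0, 0 < t → DerivZeroEq (g t) 1 (-1))
    (h2 : ∀ t : ℝ≥0, 0 < t → DerivZeroEq (g t) 2 (g₂ t))
    (h3 : ∀ t : ℝ≥0, 0 < t → DerivZeroEq (g t) 3 (g₃ t))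
    (h4 : ∀ t : ℝ≥0, 0 < t → DerivZeroEq (g t) 4 (g₄ t)) :
    (∀ (t : ℝ≥0) (n : ℕ), 0 < t → 1 ≤ n →
      ∀ (x : X) (hx : x ∈ (A.natPow 3).domain),
        ‖(hillePhillips (T.rescale (t / n)) (g t))^[n] x - T t x
            - ((2 * n : ℝ)⁻¹ * (g₂ t - 1) * (t : ℝ) ^ 2) •
              T t (A.natPow 2 ⟨x, A.natPow_domain_succ_le 2 hx⟩)‖
          ≤ T.supNorm * Real.sqrt ((g₂ t - 1) * (g₄ t - 1) / 2) * (t : ℝ) ^ 3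
              * (n : ℝ) ^ (-(3 / 2) : ℝ) * ‖A.natPow 3 ⟨x, hx⟩‖) ∧
    (∀ (t : ℝ≥0) (n : ℕ), 0 < t → 1 ≤ n →
      ∀ (x : X) (hx : x ∈ (A.natPow 4).domain),
        ‖(hillePhillips (T.rescale (t / n)) (g t))^[n] x - T t x
            - ((2 * n : ℝ)⁻¹ * (g₂ t - 1) * (t : ℝ) ^ 2) •
              T t (A.natPow 2 ⟨x, A.natPow_domain_succ_le 2 (A.natPow_domain_succ_le 3 hx)⟩)‖
          ≤ T.supNorm * (g₄ t - 1) * (t : ℝ) ^ 3 * ((n : ℝ) ^ 2)⁻¹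
              * (‖A.natPow 3 ⟨x, A.natPow_domain_succ_le 3 hx⟩‖
                + (t : ℝ) * ‖A.natPow 4 ⟨x, hx⟩‖)) := by
  refine ⟨fun t n ht hn x hx => ?_, fun t n ht hn x hx => ?_⟩
  · obtain ⟨m, k, hv, hvk, hkw, -, hμ⟩ :=
      exists_hasCentralMoments_convPow_representingMeasure
      (hcm t ht) (h0 t ht) (h1 t ht) (h2 t ht) (h3 t ht) (h4 t ht)
    have hx2 := A.natPow_domain_succ_le 2 hx
    have hx1 := A.natPow_domain_succ_le 1 hx2
    rw [hillePhillips_rescale_iterate hT (hcm t ht) (h0 t ht)]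
    refine hA.norm_sub_expansion_le_of_chain_three hT hn (hμ n) hv hvk hkw t
      -- The chain must be a total sequence; the catch-all case matters only at its first index, the
      -- top power.
      (y := fun j => match j with
        | 0 => x
        | 1 => A.natPow 1 ⟨x, hx1⟩
        | 2 => A.natPow 2 ⟨x, hx2⟩
        | _ => A.natPow 3 ⟨x, hx⟩) fun j hj => ?_
    interval_cases j
    · exact A.natPow_succ_mem_graph 0 hx1
    · exact A.natPow_succ_mem_graph 1 hx2
    · exact A.natPow_succ_mem_graph 2 hx
  · obtain ⟨m, k, -, hvk, hkw, hmw, hμ⟩ :=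
      exists_hasCentralMoments_convPow_representingMeasure
      (hcm t ht) (h0 t ht) (h1 t ht) (h2 t ht) (h3 t ht) (h4 t ht)
    have hx3 := A.natPow_domain_succ_le 3 hx
    have hx2 := A.natPow_domain_succ_le 2 hx3
    have hx1 := A.natPow_domain_succ_le 1 hx2
    rw [hillePhillips_rescale_iterate hT (hcm t ht) (h0 t ht)]
    refine hA.norm_sub_expansion_le_of_chain_four hT hn (hμ n) hvk hkw hmw t
      (y := fun j => match j with
        | 0 => x
        | 1 => A.natPow 1 ⟨x, hx1⟩
        | 2 => A.natPow 2 ⟨x, hx2⟩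
        | 3 => A.natPow 3 ⟨x, hx3⟩
        | _ => A.natPow 4 ⟨x, hx⟩) fun j hj => ?_
    interval_cases j
    · exact A.natPow_succ_mem_graph 0 hx1
    · exact A.natPow_succ_mem_graph 1 hx2
    · exact A.natPow_succ_mem_graph 2 hx3
    · exact A.natPow_succ_mem_graph 3 hx
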